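/- **Theorem A.** Let $n\ge 3$ and let $A_n$ be the alternating group on $\{1,\dots,n\}$. Consider the following graphs; "components" always means connected components. - $P_0(A_n)$ (proper power graph): the vertices are the non-identity elements of $A_n$, and $x\neq y$ are adjacent if one of them is a power of the other. $c_0(A_n)$ is the number of its components. - $\widetilde P_0(A_n)$ (proper quotient power graph): the vertices are the classes $[x]=\{y\in A_n:\langle y\rangle=\langle x\rangle\}$ of non-identity elements $x$, and two distinct classes are adjacent if some representatives of them are one a power of the other. $\widetilde c_0(A_n)$ is the number of its components. - $P_0(\mathcal T(A_n))$ (proper power type graph): the vertices are the types of the non-identity elements of $A_n$, where the type of a permutation is the partition of $n$ formed by its orbit sizes. Two distinct types are adjacent if one is a power of the other, where for a partition $T$ of $n$ and $a\in\mathbb N$ the power $T^a$ is obtained by replacing every term $x$ of $T$ by $\gcd(a,x)$ terms equal to $x/\gcd(a,x)$. $c_0(\mathcal T(A_n))$ is the number of its components. - $\mathcal O_0(A_n)$ (proper order graph): the vertices are the orders of the non-identity elements of $A_n$, and two distinct orders are adjacent if one divides the other. $c_0(\mathcal O(A_n))$ is the number of its components. Let $P$ be the set of primes, let $bP+c=\{bp+c: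 p\in P\}$, and let $A=P\cup(P+1)\cup(P+2)\cup 2P\cup(2P+1)$. Then $c_0(A_n)=\widetilde c_0(A_n)$ for all $n\ge 3$, and the following holds. (i) For $3\le n\le 10$ the values are: $$\begin{array}{c|cccccccc} n&3&4&5&6&7&8&9&10\\\hline c_0(A_n)=\widetilde c_0(A_n)&1&7&31&121&421&962&5442&29345\\ c_0(\mathcal T(A_n))&1&2&3&4&4&3&4&3\\ c_0(\mathcal O(A_n))&1&2&3&3&3&2&2&1 \end{array}$$ (ii) For $n\ge 11$ the values are: $$\begin{array}{l|c|c|c} \text{condition on } n & c_0(A_n)=\widetilde c_0(A_n) & c_0(\mathcal T(A_n)) & c_0(\mathcal O(A_n))\\\hline n-2,\ \frac{n-1}2\in P & \frac{n(n-1)(n-4)!}{2}+\frac{4n(n-2)(n-4)!}{n-1}+1 & 3&2\\ n,\ \frac{n-1}2\in P & (n-2)!+\frac{4n(n-2)(n-4)!}{n-1}+1 & 3&2\\ n,\ n-2\in P & (n-2)!+\frac{n(n-1)(n-4)!}{2}+1 & 3&3\\ n-2\in P,\ n\notin P,\ \frac{n-1}2\notin P & \frac{n(n-1)(n-4)!}{2}+1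 & 2&2\\ \frac{n-1}2\in P,\ n\notin P,\ n-2\notin P & \frac{4n(n-2)(n-4)!}{n-1}+1 & 2&1\\ n\in P,\ n-2\notin P,\ \frac{n-1}2\notin P & (n-2)!+1 & 2&2\\ n-1\in P,\ \frac n2\notin P & n(n-3)!+1 & 2&2\\ n-1,\ \frac n2\in P & \frac{4(n-1)(n-3)!}{n}+n(n-3)!+1 & 3&2\\ \frac n2\in P,\ n-1\notin P & \frac{4(n-1)(n-3)!}{n}+1 & 2&1\\ n\notin A & 1&1&1 \end{array}$$ -/

import Mathlib

/-- The subgraph obtained from `X` by deleting the vertex `x₀`. -/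
def vertexDeleted {V : Type*} (X : SimpleGraph V) (x₀ : V) : SimpleGraph {v : V // v ≠ x₀} :=
  X.induce {v : V | v ≠ x₀}

/-- The number of connected components of a graph. -/
noncomputable def numComponents {V : Type*} (X : SimpleGraph V) : ℕ :=
  Nat.card X.ConnectedComponent

/-- The quotient graph: its vertices are the equivalence classes, and two distinct classes are
adjacent when some representatives of them are adjacent in `X`. -/
def quotientGraph {V : Type*} (X : SimpleGraph V) (s : Setoid V) : SimpleGraph (Quotient s) :=
  X.map (Quotient.mk s)

/-- The power graph `P(G)`: distinct elements are adjacent when one is a power of the other. -/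
def powerGraph (G : Type*) [Group G] : SimpleGraph G :=
  SimpleGraph.fromRel fun x y : G => ∃ m : ℕ, x = y ^ m

/-- The proper power graph `P₀(G)`. -/
def properPowerGraph (G : Type*) [Group G] : SimpleGraph {x : G // x ≠ 1} :=
  vertexDeleted (powerGraph G) 1

/-- Two elements are identified when they generate the same cyclic subgroup. -/
def sameCyclic (G : Type*) [Group G] : Setoid G :=
  Setoid.ker fun x : G => Subgroup.zpowers x

/-- The quotient power graph, the quotient of `P(G)` by `sameCyclic G`. -/
def quotientPowerGraph (G : Type*) [Group G] : SimpleGraph (Quotient (sameCyclic G)) :=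
  quotientGraph (powerGraph G) (sameCyclic G)

/-- The proper quotient power graph: the class of `1` is deleted. -/
def properQuotientPowerGraph (G : Type*) [Group G] :
    SimpleGraph {c : Quotient (sameCyclic G) // c ≠ Quotient.mk (sameCyclic G) 1} :=
  vertexDeleted (quotientPowerGraph G) (Quotient.mk (sameCyclic G) 1)

/-- The set `O(G)` of element orders. -/
def elementOrders (G : Type*) [Group G] : Set ℕ := Set.range fun g : G => orderOf g

theorem one_mem_elementOrders (G : Type*) [Group G] : 1 ∈ elementOrders G :=
  ⟨1, orderOf_one⟩

/-- The order graph `O(G)`: distinct element orders are adjacent when one divides the other. -/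
def orderGraph (G : Type*) [Group G] : SimpleGraph (elementOrders G) :=
  SimpleGraph.fromRel fun a b : elementOrders G => (a : ℕ) ∣ (b : ℕ)

/-- The proper order graph: the vertex `1` is deleted. -/
def properOrderGraph (G : Type*) [Group G] :
    SimpleGraph {a : elementOrders G // a ≠ ⟨1, one_mem_elementOrders G⟩} :=
  vertexDeleted (orderGraph G) ⟨1, one_mem_elementOrders G⟩

/-- The power `T ^ a` of a partition: every term `x` of `T` is replaced by `gcd(a, x)` terms
equal to `x / gcd(a, x)`. -/
def partitionPower {n : ℕ} (T : n.Partition) (a : ℕ) : n.Partition where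
  parts := T.parts.bind fun x => Multiset.replicate (a.gcd x) (x / a.gcd x)
  parts_pos := by
    intro i hi
    obtain ⟨x, hx, hi⟩ := Multiset.mem_bind.1 hi
    rw [Multiset.eq_of_mem_replicate hi]
    exact Nat.div_pos (Nat.gcd_le_right a (T.parts_pos hx))
      (Nat.gcd_pos_of_pos_right a (T.parts_pos hx))
  parts_sum := by
    have h : ∀ x : ℕ, (Multiset.replicate (a.gcd x) (x / a.gcd x)).sum = x := by
      intro x
      rw [Multiset.sum_replicate, smul_eq_mul, Nat.mul_div_cancel' (Nat.gcd_dvd_right a x)]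
    rw [Multiset.sum_bind]
    simp only [h, Multiset.map_id']
    exact T.parts_sum

/-- The trivial partition `[1 ^ n]`. -/
def trivialPartition (n : ℕ) : n.Partition where
  parts := Multiset.replicate n 1
  parts_pos := by
    intro i hi
    rw [Multiset.eq_of_mem_replicate hi]
    exact Nat.one_pos
  parts_sum := by simp

/-- The set `T(G)` of the types (partitions into orbit sizes) of the elements of a permutation
group `G`. -/
def typeSet {α : Type*} [Fintype α] [DecidableEq α] (G : Subgroup (Equiv.Perm α)) :
    Set (Fintype.card α).Partition :=
  {T | ∃ ψ ∈ G, ψ.partition = T}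

theorem trivialPartition_mem_typeSet {α : Type*} [Fintype α] [DecidableEq α]
    (G : Subgroup (Equiv.Perm α)) : trivialPartition (Fintype.card α) ∈ typeSet G := by
  refine ⟨1, G.one_mem, ?_⟩
  apply Nat.Partition.ext
  simp [Equiv.Perm.parts_partition, trivialPartition]

/-- The power type graph `P(T(G))`: distinct types are adjacent when one is a power of the
other. -/
def powerTypeGraph {α : Type*} [Fintype α] [DecidableEq α] (G : Subgroup (Equiv.Perm α)) :
    SimpleGraph (typeSet G) :=
  SimpleGraph.fromRel fun S T : typeSet G => ∃ a : ℕ,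
    (S : (Fintype.card α).Partition) = partitionPower (T : (Fintype.card α).Partition) a

/-- The proper power type graph `P₀(T(G))`: the trivial partition is deleted. -/
def properPowerTypeGraph {α : Type*} [Fintype α] [DecidableEq α]
    (G : Subgroup (Equiv.Perm α)) :
    SimpleGraph {T : typeSet G //
      T ≠ ⟨trivialPartition (Fintype.card α), trivialPartition_mem_typeSet G⟩} :=
  vertexDeleted (powerTypeGraph G)
    ⟨trivialPartition (Fintype.card α), trivialPartition_mem_typeSet G⟩

/-- `AltCounts n c t o`: for the alternating group of degree `n`, the proper power graph and the
proper quotient power graph both have `c` components, the proper power type graph has `t`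
components and the proper order graph has `o` components. The number `c` is rational, so that
formulas with a division can be written as they stand. -/
def AltCounts (n : ℕ) (c : ℚ) (t o : ℕ) : Prop :=
  (numComponents (properPowerGraph (alternatingGroup (Fin n))) : ℚ) = c ∧
  (numComponents (properQuotientPowerGraph (alternatingGroup (Fin n))) : ℚ) = c ∧
  numComponents (properPowerTypeGraph (alternatingGroup (Fin n))) = t ∧
  numComponents (properOrderGraph (alternatingGroup (Fin n))) = o

/-- The set `b P + c = {b p + c : p prime}`. -/
def primesAffine (b c : ℕ) : Set ℕ := {x | ∃ p : ℕ, p.Prime ∧ x = b * p + c}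

/-- `A = P ∪ (P + 1) ∪ (P + 2) ∪ 2P ∪ (2P + 1)`. -/
def criticalDegrees : Set ℕ :=
  primesAffine 1 0 ∪ primesAffine 1 1 ∪ primesAffine 1 2 ∪ primesAffine 2 0 ∪ primesAffine 2 1

/-! ### Counting components by an invariant -/

open Relation

/-! Every nontrivial element has a power of prime order, so components can be read off from elements
of prime order. Commuting elements x, y of distinct prime orders are both powers of xy; conversely,
two prime-order powers of one element either generate the same subgroup or commute and have distinct
orders. Components are therefore counted by any label on prime-order elements that is constant along
these two relations and separates components (`numComponents_eq_ncard_label`). The type and order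
graphs are images of the power graph in which elements of equal type or order are glued, and the
same count applies to them; passing to the quotient power graph changes nothing, since generators of
one cyclic group are already connected.

In the alternating group an element of prime order p has a key (p, k), where k is its number of
p-cycles, and the key determines its cycle type. If x, y commute and have distinct prime orders p,
q, then xy has only p-, q- and pq-cycles, and their numbers determine both keys. `KeyLink` records
which pairs of keys arise, subject to room (n points) and parity; `keyLink_of_commute` and
`exists_commute_of_keyLink` make this exact. The problem becomes arithmetic of keys.

A key without links contributes one component for each subgroup of that kind to the power graph, one
component to the type graph, and something to the order graph only when every key with the same
prime is isolated. For n ≥ 11 the isolated keys are those in `Cramped`: (p, 1) with n ≤ p + 2 and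
(p, 2) with n ≤ 2p + 1. There, the only second prime with enough points would be 2, acting by a
single transposition or inside a single 2p-cycle, and parity forbids this. All other keys are joined
to (3, 1). All 3-cycles share one component as soon as n ≥ 8 (`mainKey_three`), because the
permutations preserving that component include every transposition. So each table entry is 1 plus
contributions of (n, 1), (n - 1, 1), (n - 2, 1) and (⌊n/2⌋, 2).

Small degrees deviate for lack of room. No links exist up to degree 6. In degree 7 the linked part
splits into one component per 3-subset. In degrees 8 and 9 there are two linked classes of keys. In
degrees 9 and 10 the key (3, 3) is isolated, since joining it to an involution takes 11 points. -/

theorem numComponents_eq_ncard_range {V W γ : Type*} (X : SimpleGraph V) (Y : SimpleGraph W)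
    (π : V → W) (hsurj : Function.Surjective π)
    (hXY : ∀ x y, X.Adj x y → π x = π y ∨ Y.Adj (π x) (π y))
    (hYX : ∀ u v, Y.Adj u v → ∃ x y, π x = u ∧ π y = v ∧ X.Adj x y)
    (F : V → γ) (hF : ∀ x y, X.Adj x y → F x = F y) (hπ : ∀ x y, π x = π y → F x = F y)
    (hr : ∀ x y, F x = F y → Relation.EqvGen (fun a b => X.Adj a b ∨ π a = π b) x y) :
    numComponents Y = (Set.range F).ncard := by
  have hreach : ∀ x y, F x = F y → Y.Reachable (π x) (π y) := by
    intro x y h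
    have h' := hr x y h
    clear h
    induction h' with
    | rel x y h =>
      rcases h with h | h
      · rcases hXY x y h with h | h
        · rw [h]
        · exact h.reachable
      · rw [h]
    | refl x => exact SimpleGraph.Reachable.refl _
    | symm x y h ih => exact ih.symm
    | trans x y z h1 h2 ih1 ih2 => exact ih1.trans ih2
  -- A walk in `Y` lifts to `X` edge by edge. Consecutive lifted edges need not meet: they only end
  -- and begin in the same fibre of `π`, a jump which `hπ` absorbs.
  have hconst : ∀ x y, Y.Reachable (π x) (π y) → F x = F y := by
    suffices ∀ u v, Y.Walk u v → ∀ x y, π x = u → π y = v → F x = F y from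
      fun x y ⟨w⟩ => this _ _ w x y rfl rfl
    intro u v w
    induction w with
    | nil => exact fun x y hu hv => hπ _ _ (hu.trans hv.symm)
    | cons h w ih =>
      intro x y hu hv
      obtain ⟨x', y', h1, h2, h3⟩ := hYX _ _ h
      exact (hπ x x' (hu.trans h1.symm)).trans ((hF _ _ h3).trans (ih y' y h2 hv))
  rw [numComponents, ← Nat.card_coe_set_eq]
  refine Nat.card_congr (Equiv.symm ?_)
  refine Equiv.ofBijective
    (fun z : Set.range F => Y.connectedComponentMk (π (Classical.choose z.2))) ⟨?_, ?_⟩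
  · rintro z z' h
    have h1 := hconst _ _ (SimpleGraph.ConnectedComponent.exact h)
    rw [Classical.choose_spec z.2, Classical.choose_spec z'.2] at h1
    exact Subtype.ext h1
  · intro c
    induction c using SimpleGraph.ConnectedComponent.ind with | _ w => ?_
    obtain ⟨x, rfl⟩ := hsurj w
    refine ⟨⟨F x, x, rfl⟩, SimpleGraph.ConnectedComponent.sound (hreach _ _ ?_)⟩
    exact Classical.choose_spec (p := fun y => F y = F x) ⟨x, rfl⟩

/-! ### Reduction of the power graph to elements of prime order -/

section PowerGraph

variable {G : Type*} [Group G]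

theorem properPowerGraph_adj {x y : {x : G // x ≠ 1}} :
    (properPowerGraph G).Adj x y ↔
      x ≠ y ∧ ((∃ m : ℕ, (x : G) = y ^ m) ∨ ∃ m : ℕ, (y : G) = x ^ m) := by
  simp [properPowerGraph, vertexDeleted, powerGraph, SimpleGraph.fromRel_adj, Subtype.ext_iff]

/-- `x` and `y` are nontrivial and lie in the same component of the proper power graph. -/
def PowReach (x y : G) : Prop :=
  ∃ (hx : x ≠ 1) (hy : y ≠ 1), (properPowerGraph G).Reachable ⟨x, hx⟩ ⟨y, hy⟩

theorem PowReach.refl {x : G} (hx : x ≠ 1) : PowReach x x :=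
  ⟨hx, hx, SimpleGraph.Reachable.refl _⟩

theorem PowReach.symm {x y : G} (h : PowReach x y) : PowReach y x :=
  ⟨h.2.1, h.1, h.2.2.symm⟩

theorem PowReach.trans {x y z : G} (h : PowReach x y) (h' : PowReach y z) : PowReach x z :=
  ⟨h.1, h'.2.1, h.2.2.trans h'.2.2⟩

theorem PowReach.pow {x : G} {m : ℕ} (h : x ^ m ≠ 1) : PowReach x (x ^ m) := by
  have hx : x ≠ 1 := by rintro rfl; simp at h
  refine ⟨hx, h, ?_⟩
  by_cases he : x = x ^ m
  · have : (⟨x, hx⟩ : {x : G // x ≠ 1}) = ⟨x ^ m, h⟩ := Subtype.ext he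
    rw [this]
  · exact (properPowerGraph_adj.2 ⟨fun h' => he (congrArg Subtype.val h'),
      Or.inr ⟨m, rfl⟩⟩).reachable

/-- By the Chinese remainder theorem some exponent m is 1 modulo the order of x and 0 modulo the
order of y, so (xy)^m = x. By symmetry both x and y are powers of xy. -/
theorem PowReach.of_commute {x y : G} (hx : x ≠ 1) (hy : y ≠ 1) (hxy : Commute x y)
    (hc : (orderOf x).Coprime (orderOf y)) : PowReach x y := by
  have key : ∀ {x y : G}, x ≠ 1 → Commute x y → (orderOf x).Coprime (orderOf y) →
      PowReach (x * y) x := by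
    intro x y hx hxy hc
    obtain ⟨m, hm0, hm1⟩ : ∃ m, m ≡ 1 [MOD orderOf x] ∧ m ≡ 0 [MOD orderOf y] :=
      ⟨_, (Nat.chineseRemainder hc 1 0).2⟩
    have h : (x * y) ^ m = x := by
      rw [hxy.mul_pow, orderOf_dvd_iff_pow_eq_one.1 ((Nat.modEq_zero_iff_dvd).1 hm1), mul_one]
      simpa using pow_eq_pow_iff_modEq.2 hm0
    have := PowReach.pow (x := x * y) (m := m) (by rwa [h])
    rwa [h] at this
  refine (key hx hxy hc).symm.trans ?_
  rw [hxy.eq]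
  exact key hy hxy.symm hc.symm

theorem PowReach.of_zpowers_eq [Finite G] {x y : G} (hx : x ≠ 1)
    (h : Subgroup.zpowers x = Subgroup.zpowers y) : PowReach x y := by
  have hy : y ∈ Subgroup.zpowers x := h ▸ Subgroup.mem_zpowers y
  rw [← mem_powers_iff_mem_zpowers] at hy
  obtain ⟨m, rfl⟩ := hy
  refine PowReach.pow fun h1 => hx ?_
  dsimp only at h
  rwa [h1, Subgroup.zpowers_one_eq_bot, Subgroup.zpowers_eq_bot] at h

/-- Needed for conjugation by arbitrary permutations, odd ones included, which act on the
alternating group by automorphisms. -/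
theorem PowReach.map {H : Type*} [Group H] (f : G ≃* H) {x y : G} (h : PowReach x y) :
    PowReach (f x) (f y) := by
  obtain ⟨hx, hy, ⟨w⟩⟩ := h
  suffices ∀ u v : {x : G // x ≠ 1}, (properPowerGraph G).Walk u v → PowReach (f u) (f v) from
    this _ _ w
  intro u v w
  induction w with
  | @nil u => exact PowReach.refl (by simpa using u.2)
  | @cons u v w hadj _ ih =>
    refine PowReach.trans ?_ ih
    have hu : f u ≠ 1 := by simpa using u.2
    have hv : f v ≠ 1 := by simpa using v.2
    rcases (properPowerGraph_adj.1 hadj).2 with ⟨m, hm⟩ | ⟨m, hm⟩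
    · rw [hm, map_pow] at hu ⊢
      exact (PowReach.pow hu).symm
    · rw [hm, map_pow] at hv ⊢
      exact PowReach.pow hv

theorem eqvGen_of_powReach {r : {x : G // x ≠ 1} → {x : G // x ≠ 1} → Prop}
    (hr : ∀ x y, (properPowerGraph G).Adj x y → r x y) {x y : {x : G // x ≠ 1}}
    (h : PowReach (x : G) y) : Relation.EqvGen r x y := by
  obtain ⟨w⟩ : (properPowerGraph G).Reachable x y := h.2.2
  clear h
  induction w with
  | nil => exact Relation.EqvGen.refl _
  | cons h _ ih => exact Relation.EqvGen.trans _ _ _ (Relation.EqvGen.rel _ _ (hr _ _ h)) ih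

/-- A power of `x` which has prime order if `x` is a nontrivial element of finite order. -/
noncomputable def primePart (x : G) : G := x ^ (orderOf x / (orderOf x).minFac)

theorem orderOf_primePart [Finite G] (x : G) :
    orderOf (primePart x) = (orderOf x).minFac := by
  have h0 := orderOf_pos x
  have hd := Nat.minFac_dvd (orderOf x)
  rw [primePart, orderOf_pow_of_dvd _ (Nat.div_dvd_of_dvd hd), Nat.div_div_self hd h0.ne']
  exact (Nat.div_pos (Nat.minFac_le h0) (Nat.minFac_pos _)).ne'

theorem prime_orderOf_primePart [Finite G] {x : G} (hx : x ≠ 1) :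
    (orderOf (primePart x)).Prime := by
  rw [orderOf_primePart x]
  exact Nat.minFac_prime (by rwa [Ne, orderOf_eq_one_iff])

theorem ne_one_of_prime_orderOf {x : G} (h : (orderOf x).Prime) : x ≠ 1 := by
  rintro rfl
  simp [Nat.not_prime_one] at h

theorem primePart_of_prime {x : G} (h : (orderOf x).Prime) : primePart x = x := by
  rw [primePart, h.minFac_eq, Nat.div_self h.pos, pow_one]

theorem PowReach.primePart [Finite G] {x : G} (hx : x ≠ 1) : PowReach x (primePart x) :=
  PowReach.pow (ne_one_of_prime_orderOf (prime_orderOf_primePart hx))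

/-- With a = y^i and d = gcd(orderOf y, i), Bézout's identity makes y^d a power of a, while d ∣ i
gives the converse. Hence a cyclic group has at most one subgroup of each order. -/
theorem zpowers_eq_zpowers_pow_div [Finite G] {y a : G} (ha : a ∈ Subgroup.zpowers y) :
    Subgroup.zpowers a = Subgroup.zpowers (y ^ (orderOf y / orderOf a)) := by
  rw [← mem_powers_iff_mem_zpowers] at ha
  obtain ⟨i, rfl⟩ := ha
  dsimp only
  rw [orderOf_pow, Nat.div_div_self (Nat.gcd_dvd_left _ _) (orderOf_pos y).ne']
  apply le_antisymm
  · rw [Subgroup.zpowers_le]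
    obtain ⟨j, hj⟩ := Nat.gcd_dvd_right (orderOf y) i
    nth_rw 2 [hj]
    rw [pow_mul]
    exact pow_mem (Subgroup.mem_zpowers _) _
  · rw [Subgroup.zpowers_le]
    refine ⟨Nat.gcdB (orderOf y) i, ?_⟩
    dsimp only
    rw [← zpow_natCast y (Nat.gcd _ _), Nat.gcd_eq_gcd_ab, zpow_add, zpow_mul, zpow_mul]
    simp

theorem zpowers_eq_of_orderOf_eq [Finite G] {y a b : G} (ha : a ∈ Subgroup.zpowers y)
    (hb : b ∈ Subgroup.zpowers y) (h : orderOf a = orderOf b) :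
    Subgroup.zpowers a = Subgroup.zpowers b := by
  rw [zpowers_eq_zpowers_pow_div ha, zpowers_eq_zpowers_pow_div hb, h]

/-- Both prime parts lie in the cyclic group of y. If their orders agree they generate the same
subgroup, and otherwise they commute and have distinct prime orders; the two hypotheses on `L` cover
these cases. -/
theorem label_primePart_pow [Finite G] {γ : Type*} {L : G → γ}
    (hcyc : ∀ x y, (orderOf x).Prime → Subgroup.zpowers x = Subgroup.zpowers y → L x = L y)
    (hcomm : ∀ x y, Commute x y → (orderOf x).Prime → (orderOf y).Prime →
      orderOf x ≠ orderOf y → L x = L y) {y : G} {m : ℕ} (h : y ^ m ≠ 1) :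
    L (primePart (y ^ m)) = L (primePart y) := by
  have hy : y ≠ 1 := by rintro rfl; simp at h
  have h1 : primePart (y ^ m) ∈ Subgroup.zpowers y :=
    pow_mem (pow_mem (Subgroup.mem_zpowers y) _) _
  have h2 : primePart y ∈ Subgroup.zpowers y := pow_mem (Subgroup.mem_zpowers y) _
  by_cases ho : orderOf (primePart (y ^ m)) = orderOf (primePart y)
  · exact hcyc _ _ (prime_orderOf_primePart h) (zpowers_eq_of_orderOf_eq h1 h2 ho)
  · refine hcomm _ _ ?_ (prime_orderOf_primePart h) (prime_orderOf_primePart hy) ho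
    exact ((Commute.refl y).pow_left m).pow_pow _ _

/-- The common engine for all the graphs: every nontrivial element takes the label of its prime
part, to which it is connected, so that `L` has to be controlled on elements of prime order only.
The map `π` says which elements are glued. -/
theorem numComponents_eq_ncard_label [Finite G] {W γ : Type*} (Y : SimpleGraph W)
    (π : {x : G // x ≠ 1} → W) (hsurj : Function.Surjective π)
    (hXY : ∀ x y, (properPowerGraph G).Adj x y → π x = π y ∨ Y.Adj (π x) (π y))
    (hYX : ∀ u v, Y.Adj u v → ∃ x y, π x = u ∧ π y = v ∧ (properPowerGraph G).Adj x y)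
    (L : G → γ)
    (hcyc : ∀ x y, (orderOf x).Prime → Subgroup.zpowers x = Subgroup.zpowers y → L x = L y)
    (hcomm : ∀ x y, Commute x y → (orderOf x).Prime → (orderOf y).Prime →
      orderOf x ≠ orderOf y → L x = L y)
    (hπ : ∀ x y, π x = π y → L (primePart x) = L (primePart y))
    (hr : ∀ x y : {x : G // x ≠ 1}, (orderOf (x : G)).Prime → (orderOf (y : G)).Prime →
      L x = L y → Relation.EqvGen (fun a b => (properPowerGraph G).Adj a b ∨ π a = π b) x y) :
    numComponents Y = (L '' {x | (orderOf x).Prime}).ncard := by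
  have hrange : L '' {x | (orderOf x).Prime} =
      Set.range fun x : {x : G // x ≠ 1} => L (primePart (x : G)) := by
    ext z
    constructor
    · rintro ⟨x, hx, rfl⟩
      exact ⟨⟨x, ne_one_of_prime_orderOf hx⟩, congrArg L (primePart_of_prime hx)⟩
    · rintro ⟨x, rfl⟩
      exact ⟨_, prime_orderOf_primePart x.2, rfl⟩
  rw [hrange]
  refine numComponents_eq_ncard_range _ Y π hsurj hXY hYX _ ?_ hπ ?_
  · intro x y h
    rcases (properPowerGraph_adj.1 h).2 with ⟨m, hm⟩ | ⟨m, hm⟩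
    · simp only [hm]
      exact label_primePart_pow hcyc hcomm (hm ▸ x.2)
    · simp only [hm]
      exact (label_primePart_pow hcyc hcomm (hm ▸ y.2)).symm
  · intro x y h
    have hpx := prime_orderOf_primePart x.2
    have hpy := prime_orderOf_primePart y.2
    have h1 := hr ⟨_, ne_one_of_prime_orderOf hpx⟩ ⟨_, ne_one_of_prime_orderOf hpy⟩ hpx hpy h
    refine Relation.EqvGen.trans _ _ _ (eqvGen_of_powReach (fun _ _ => Or.inl) ?_)
      (Relation.EqvGen.trans _ _ _ h1 (eqvGen_of_powReach (fun _ _ => Or.inl) ?_))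
    · exact PowReach.primePart x.2
    · exact (PowReach.primePart y.2).symm

theorem numComponents_properPowerGraph [Finite G] {γ : Type*} (L : G → γ)
    (hcyc : ∀ x y, (orderOf x).Prime → Subgroup.zpowers x = Subgroup.zpowers y → L x = L y)
    (hcomm : ∀ x y, Commute x y → (orderOf x).Prime → (orderOf y).Prime →
      orderOf x ≠ orderOf y → L x = L y)
    (hr : ∀ x y : G, (orderOf x).Prime → (orderOf y).Prime → L x = L y → PowReach x y) :
    numComponents (properPowerGraph G) = (L '' {x | (orderOf x).Prime}).ncard :=
  numComponents_eq_ncard_label _ id Function.surjective_id (fun _ _ h => Or.inr h)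
    (fun u v h => ⟨u, v, rfl, rfl, h⟩) L hcyc hcomm (fun _ _ h => congrArg _ (congrArg _
      (congrArg Subtype.val h)))
    (fun x y hx hy h => eqvGen_of_powReach (fun _ _ => Or.inl) (hr x y hx hy h))

/-- Elements generating the same subgroup are powers of each other, so the gluing happens inside
components. The label used is the component in the power graph itself. -/
theorem numComponents_properQuotientPowerGraph (G : Type*) [Group G] [Finite G] :
    numComponents (properPowerGraph G) = numComponents (properQuotientPowerGraph G) := by
  have hne : ∀ x : G, x ≠ 1 → Quotient.mk (sameCyclic G) x ≠ Quotient.mk (sameCyclic G) 1 := by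
    intro x hx h
    have h1 : Subgroup.zpowers x = Subgroup.zpowers 1 := Quotient.exact h
    rw [Subgroup.zpowers_one_eq_bot, Subgroup.zpowers_eq_bot] at h1
    exact hx h1
  have hZ : ∀ x y : {x : G // x ≠ 1},
      Quotient.mk (sameCyclic G) (x : G) = Quotient.mk (sameCyclic G) (y : G) →
      (properPowerGraph G).Reachable x y := by
    intro x y h
    exact (PowReach.of_zpowers_eq x.2 (Quotient.exact h)).2.2
  rw [numComponents_eq_ncard_range (properPowerGraph G) (properQuotientPowerGraph G)
    (fun x => ⟨Quotient.mk _ (x : G), hne x x.2⟩) ?_ ?_ ?_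
    (fun x => (properPowerGraph G).connectedComponentMk x) ?_ ?_ ?_]
  · rw [numComponents, Set.range_eq_univ.2, Set.ncard_univ]
    exact fun c => c.exists_rep
  · rintro ⟨c, hc⟩
    induction c using Quotient.inductionOn with | _ x => ?_
    exact ⟨⟨x, fun h => hc (by rw [h])⟩, rfl⟩
  · intro x y h
    rw [or_iff_not_imp_left]
    intro hq
    refine ⟨fun h' => hq (Subtype.ext h'), x, y, ?_, rfl, rfl⟩
    exact h
  · rintro ⟨u, hu⟩ ⟨v, hv⟩ ⟨hne, x, y, hadj, hx, hy⟩
    simp only [Function.Embedding.subtype_apply] at hx hy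
    subst hx hy
    exact ⟨⟨x, fun h => hu (by rw [h])⟩, ⟨y, fun h => hv (by rw [h])⟩, rfl, rfl, hadj⟩
  · exact fun x y h => SimpleGraph.ConnectedComponent.sound h.reachable
  · exact fun x y h => SimpleGraph.ConnectedComponent.sound (hZ x y (congrArg Subtype.val h))
  · intro x y h
    exact eqvGen_of_powReach (fun _ _ => Or.inl)
      ⟨x.2, y.2, SimpleGraph.ConnectedComponent.exact h⟩

end PowerGraph

/-! ### Cycle types and partitions of powers -/

open Equiv Equiv.Perm in
theorem Equiv.Perm.IsCycle.cycleType_pow {α : Type*} [Fintype α] [DecidableEq α] {c : Perm α}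
    (hc : c.IsCycle) (m : ℕ) :
    (c ^ m).cycleType = (Multiset.replicate (m.gcd c.support.card)
      (c.support.card / m.gcd c.support.card)).filter (· ≠ 1) := by
  have hpos : 0 < c.support.card := by
    have := hc.two_le_card_support
    omega
  set ℓ := c.support.card with hℓ
  have hg : m.gcd ℓ ∣ ℓ := Nat.gcd_dvd_right _ _
  have ho : orderOf (c ^ m) = ℓ / m.gcd ℓ := by
    rw [orderOf_pow, hc.orderOf, Nat.gcd_comm]
  rw [← ho]
  by_cases h1 : c ^ m = 1
  · simp only [h1, cycleType_one, orderOf_one]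
    rw [eq_comm, Multiset.filter_eq_nil]
    intro a ha
    simp [Multiset.eq_of_mem_replicate ha]
  · have ho1 : orderOf (c ^ m) ≠ 1 := by rwa [Ne, orderOf_eq_one_iff]
    rw [Multiset.filter_eq_self.2 fun a ha => by rwa [Multiset.eq_of_mem_replicate ha]]
    -- All cycles of c^m have length equal to its order. If r is the length of a cycle through x,
    -- then c^(mr) fixes x, a point moved by the cycle c; a power of a cycle fixing a moved point is
    -- trivial, so the order divides r.
    have hall : ∀ r ∈ (c ^ m).cycleType, r = orderOf (c ^ m) := by
      intro r hr
      refine Nat.dvd_antisymm (dvd_of_mem_cycleType hr) ?_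
      rw [cycleType_def, Multiset.mem_map] at hr
      obtain ⟨f, hf, rfl⟩ := hr
      have hf' : f ∈ (c ^ m).cycleFactorsFinset := hf
      rw [mem_cycleFactorsFinset_iff] at hf'
      obtain ⟨x, hx⟩ := hf'.1.nonempty_support
      rw [orderOf_dvd_iff_pow_eq_one, ← pow_mul, hc.pow_eq_one_iff]
      refine ⟨x, ?_, ?_⟩
      · intro h
        have h2 := hf'.2 x hx
        rw [mem_support, h2] at hx
        exact hx (pow_apply_eq_self_of_apply_eq_self h m)
      · have hiter : ∀ j : ℕ, ((c ^ m) ^ j) x = (f ^ j) x := by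
          intro j
          induction j with
          | zero => rfl
          | succ j ih =>
            rw [pow_succ', pow_succ', mul_apply, mul_apply, ih, hf'.2]
            exact pow_apply_mem_support.2 hx
        rw [pow_mul, hiter]
        have := hf'.1.orderOf
        simp only [Function.comp_apply, ← this, pow_orderOf_eq_one, coe_one, id]
    have hrep := Multiset.eq_replicate_card.2 hall
    have hsum := sum_cycleType (c ^ m)
    have hsupp : (c ^ m).support = c.support := by
      rw [hc.support_pow_eq_iff, orderOf_dvd_iff_pow_eq_one]
      exact h1
    rw [hrep, Multiset.sum_replicate, smul_eq_mul, hsupp, ← hℓ] at hsum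
    have hgo : m.gcd ℓ * orderOf (c ^ m) = ℓ := by
      rw [ho, Nat.mul_div_cancel' hg]
    rw [hrep]
    congr 1
    -- The number of cycles follows by counting points: a nontrivial power of c moves exactly the
    -- points that c moves.
    exact Nat.eq_of_mul_eq_mul_right (orderOf_pos _) (hsum.trans hgo.symm)

/-- The multiset obtained from `s` by replacing every `x` by `gcd(m, x)` copies of
`x / gcd(m, x)`. -/
def multisetPower (s : Multiset ℕ) (m : ℕ) : Multiset ℕ :=
  s.bind fun x => Multiset.replicate (m.gcd x) (x / m.gcd x)

theorem multisetPower_add (s t : Multiset ℕ) (m : ℕ) :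
    multisetPower (s + t) m = multisetPower s m + multisetPower t m :=
  Multiset.add_bind _ _ _

theorem multisetPower_singleton (x m : ℕ) :
    multisetPower {x} m = Multiset.replicate (m.gcd x) (x / m.gcd x) :=
  Multiset.singleton_bind _ _

theorem multisetPower_replicate (k x m : ℕ) :
    multisetPower (Multiset.replicate k x) m =
      Multiset.replicate (k * m.gcd x) (x / m.gcd x) := by
  induction k with
  | zero => simp [multisetPower]
  | succ k ih =>
    rw [Multiset.replicate_succ, ← Multiset.singleton_add, multisetPower_add, ih,
      multisetPower_singleton, ← Multiset.replicate_add]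
    congr 1
    ring

theorem Equiv.Perm.cycleType_pow {α : Type*} [Fintype α] [DecidableEq α] (g : Equiv.Perm α)
    (m : ℕ) : (g ^ m).cycleType = (multisetPower g.cycleType m).filter (· ≠ 1) := by
  induction g using Equiv.Perm.cycle_induction_on with
  | base_one => simp [multisetPower]
  | base_cycles c hc =>
    rw [hc.cycleType_pow, hc.cycleType, multisetPower_singleton]
  | induction_disjoint c g hd _ ihc ihg =>
    rw [hd.commute.mul_pow, (hd.pow_disjoint_pow m m).cycleType_mul, ihc, ihg,
      hd.cycleType_mul, multisetPower_add, Multiset.filter_add]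

/-- The sum n fixes the number of ones. This bridges partitions, which record fixed points, and
cycle types, which drop them. -/
theorem Nat.Partition.ext_filter {n : ℕ} {p q : n.Partition}
    (h : p.parts.filter (· ≠ 1) = q.parts.filter (· ≠ 1)) : p = q := by
  have key : ∀ p : n.Partition, p.parts = p.parts.filter (· ≠ 1) +
      Multiset.replicate (n - (p.parts.filter (· ≠ 1)).sum) 1 := by
    intro p
    have h1 : p.parts.filter (fun x => ¬ (x ≠ 1)) =
        Multiset.replicate (Multiset.card (p.parts.filter (fun x => ¬ (x ≠ 1)))) 1 :=
      Multiset.eq_replicate_card.2 fun a ha => by simpa using (Multiset.mem_filter.1 ha).2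
    have h2 := Multiset.filter_add_not (fun x => x ≠ 1) p.parts
    have h3 : (p.parts.filter (· ≠ 1)).sum +
        Multiset.card (p.parts.filter (fun x => ¬ (x ≠ 1))) = n := by
      conv_rhs => rw [← p.parts_sum, ← h2, Multiset.sum_add]
      conv_rhs => rw [h1]
      simp
    conv_lhs => rw [← h2, h1]
    congr 2
    omega
  ext1
  rw [key p, key q, h]

theorem Equiv.Perm.filter_parts_partition {α : Type*} [Fintype α] [DecidableEq α]
    (g : Equiv.Perm α) : g.partition.parts.filter (· ≠ 1) = g.cycleType := by
  rw [← Equiv.Perm.filter_parts_partition_eq_cycleType]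
  refine Multiset.filter_congr fun x hx => ?_
  have := g.partition.parts_pos hx
  omega

theorem Equiv.Perm.partition_pow {α : Type*} [Fintype α] [DecidableEq α] (g : Equiv.Perm α)
    (m : ℕ) : (g ^ m).partition = partitionPower g.partition m := by
  apply Nat.Partition.ext_filter
  rw [Equiv.Perm.filter_parts_partition, Equiv.Perm.cycleType_pow]
  change _ = (multisetPower g.partition.parts m).filter (· ≠ 1)
  rw [Equiv.Perm.parts_partition, multisetPower_add, multisetPower_replicate,
    Multiset.filter_add, Nat.gcd_one_right, Nat.div_one]
  rw [left_eq_add, Multiset.filter_eq_nil]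
  intro a ha
  simp [Multiset.eq_of_mem_replicate ha]

theorem Equiv.Perm.partition_eq_iff {α : Type*} [Fintype α] [DecidableEq α]
    {g h : Equiv.Perm α} : g.partition = h.partition ↔ g.cycleType = h.cycleType := by
  rw [← Equiv.Perm.partition_eq_of_isConj, Equiv.Perm.isConj_iff_cycleType_eq]

theorem Equiv.Perm.partition_eq_trivialPartition_iff {α : Type*} [Fintype α] [DecidableEq α]
    {g : Equiv.Perm α} : g.partition = trivialPartition (Fintype.card α) ↔ g = 1 := by
  have h1 : (1 : Equiv.Perm α).partition = trivialPartition (Fintype.card α) := by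
    apply Nat.Partition.ext
    simp [Equiv.Perm.parts_partition, trivialPartition]
  rw [← h1, Equiv.Perm.partition_eq_iff, Equiv.Perm.cycleType_one, Equiv.Perm.cycleType_eq_zero]

theorem cycleType_eq_replicate_of_prime {α : Type*} [Fintype α] [DecidableEq α]
    {g : Equiv.Perm α} (h : (orderOf g).Prime) :
    g.cycleType = Multiset.replicate (Multiset.card g.cycleType) (orderOf g) := by
  obtain ⟨k, hk⟩ := Equiv.Perm.cycleType_prime_order h
  rw [hk, Multiset.card_replicate]

theorem orderOf_eq_of_cycleType_eq {α : Type*} [Fintype α] [DecidableEq α]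
    {g h : Equiv.Perm α} (hgh : g.cycleType = h.cycleType) : orderOf g = orderOf h := by
  rw [← Equiv.Perm.lcm_cycleType, ← Equiv.Perm.lcm_cycleType, hgh]

theorem orderOf_of_cycleType_replicate {α : Type*} [Fintype α] [DecidableEq α]
    {g : Equiv.Perm α} {k p : ℕ} (hk : 0 < k) (h : g.cycleType = Multiset.replicate k p) :
    orderOf g = p := by
  rw [← Equiv.Perm.lcm_cycleType, h]
  refine Nat.dvd_antisymm (Multiset.lcm_dvd.2 fun b hb => ?_) (Multiset.dvd_lcm ?_)
  · rw [Multiset.eq_of_mem_replicate hb]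
  · exact Multiset.mem_replicate.2 ⟨hk.ne', rfl⟩

theorem even_iff_of_cycleType {α : Type*} [Fintype α] [DecidableEq α] (g : Equiv.Perm α) :
    g ∈ alternatingGroup α ↔ Even (g.cycleType.sum + Multiset.card g.cycleType) := by
  rw [Equiv.Perm.mem_alternatingGroup, Equiv.Perm.sign_of_cycleType]
  exact neg_one_pow_eq_one_iff_even (by decide)

theorem exists_alternating_cycleType {n : ℕ} {m : Multiset ℕ} (hsum : m.sum ≤ n)
    (h2 : ∀ a ∈ m, 2 ≤ a) (he : Even (m.sum + Multiset.card m)) :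
    ∃ x : alternatingGroup (Fin n), (x : Equiv.Perm (Fin n)).cycleType = m := by
  obtain ⟨g, rfl⟩ := (Equiv.Perm.exists_with_cycleType_iff (Fin n)).2
    ⟨by rwa [Fintype.card_fin], h2⟩
  exact ⟨⟨g, (even_iff_of_cycleType g).2 he⟩, rfl⟩

/-! ### Keys of prime-order elements and links between them -/

/-- The possible values of `elementKey` on elements of prime order. -/
def keys (n : ℕ) : Set (ℕ × ℕ) :=
  {κ | κ.1.Prime ∧ 0 < κ.2 ∧ κ.1 * κ.2 ≤ n ∧ (κ.1 = 2 → Even κ.2)}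

/-- There is an even permutation of `n` points having powers of the two given cycle shapes, with
`a`, `b`, `c` cycles of length `p`, `q`, `p * q`. -/
def KeyLink (n : ℕ) (κ κ' : ℕ × ℕ) : Prop :=
  κ.1.Prime ∧ κ'.1.Prime ∧ κ.1 ≠ κ'.1 ∧ 0 < κ.2 ∧ 0 < κ'.2 ∧ ∃ a b c : ℕ,
    κ.2 = a + κ'.1 * c ∧ κ'.2 = b + κ.1 * c ∧ κ.1 * a + κ'.1 * b + κ.1 * κ'.1 * c ≤ n ∧
    (κ.1 = 2 → Even (a + c)) ∧ (κ'.1 = 2 → Even (b + c))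

theorem KeyLink.symm {n : ℕ} {κ κ' : ℕ × ℕ} (h : KeyLink n κ κ') : KeyLink n κ' κ := by
  obtain ⟨h1, h2, h3, h4, h5, a, b, c, h6, h7, h8, h9, h10⟩ := h
  exact ⟨h2, h1, h3.symm, h5, h4, b, a, c, h7, h6, by linarith, h10, h9⟩

theorem KeyLink.mem_left {n : ℕ} {κ κ' : ℕ × ℕ} (h : KeyLink n κ κ') : κ ∈ keys n := by
  obtain ⟨h1, h2, h3, h4, h5, a, b, c, h6, h7, h8, h9, h10⟩ := h
  refine ⟨h1, h4, ?_, ?_⟩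
  · rw [h6]
    nlinarith [Nat.zero_le (κ'.1 * b)]
  · intro hp
    -- Here p = 2, so the other prime q is odd and a + qc has the parity of a + c.
    have hq : Odd κ'.1 := h2.odd_of_ne_two fun h => h3 (hp.trans h.symm)
    have := h9 hp
    rw [h6]
    rw [Nat.even_add] at this ⊢
    rw [Nat.even_mul, this]
    simp [Nat.not_even_iff_odd.2 hq]

theorem KeyLink.mem_right {n : ℕ} {κ κ' : ℕ × ℕ} (h : KeyLink n κ κ') : κ' ∈ keys n :=
  h.symm.mem_left

/-- The order of a permutation together with the number of its nontrivial cycles. -/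
noncomputable def elementKey {n : ℕ} (x : alternatingGroup (Fin n)) : ℕ × ℕ :=
  (orderOf x, Multiset.card (x : Equiv.Perm (Fin n)).cycleType)

section Keys

variable {n : ℕ}

theorem cycleType_eq_of_prime {x : alternatingGroup (Fin n)} (h : (orderOf x).Prime) :
    (x : Equiv.Perm (Fin n)).cycleType =
      Multiset.replicate (elementKey x).2 (elementKey x).1 := by
  have := cycleType_eq_replicate_of_prime (g := (x : Equiv.Perm (Fin n)))
    (by rwa [Subgroup.orderOf_coe])
  rwa [Subgroup.orderOf_coe] at this

theorem elementKey_of_cycleType {x : alternatingGroup (Fin n)} {k p : ℕ} (hk : 0 < k)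
    (h : (x : Equiv.Perm (Fin n)).cycleType = Multiset.replicate k p) :
    elementKey x = (p, k) := by
  rw [elementKey, h, Multiset.card_replicate, ← Subgroup.orderOf_coe,
    orderOf_of_cycleType_replicate hk h]

theorem even_replicate {k p : ℕ} (hp : p.Prime) :
    Even (k * p + k) ↔ (p = 2 → Even k) := by
  rcases hp.eq_two_or_odd' with rfl | h
  · simp [Nat.even_add]
  · have : p ≠ 2 := by rintro rfl; exact absurd h (by decide)
    have h2 : Even (p + 1) := h.add_one
    simp only [this, false_imp_iff, iff_true]
    have : k * p + k = k * (p + 1) := by ring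
    rw [this]
    exact h2.mul_left k

theorem elementKey_mem_keys {x : alternatingGroup (Fin n)} (h : (orderOf x).Prime) :
    elementKey x ∈ keys n := by
  have h1 := cycleType_eq_of_prime h
  have h2 := Equiv.Perm.sum_cycleType_le (x : Equiv.Perm (Fin n))
  have h3 := (even_iff_of_cycleType (x : Equiv.Perm (Fin n))).1 x.2
  rw [h1] at h2 h3
  simp only [Multiset.sum_replicate, smul_eq_mul, Fintype.card_fin, Multiset.card_replicate]
    at h2 h3
  refine ⟨h, ?_, by rwa [mul_comm], (even_replicate h).1 h3⟩
  exact (Equiv.Perm.card_cycleType_pos (σ := (x : Equiv.Perm (Fin n)))).2 fun h1 =>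
    ne_one_of_prime_orderOf h (Subtype.ext h1)

theorem exists_elementKey_eq {κ : ℕ × ℕ} (h : κ ∈ keys n) :
    ∃ x : alternatingGroup (Fin n), (orderOf x).Prime ∧ elementKey x = κ := by
  obtain ⟨hp, hk, hs, he⟩ := h
  obtain ⟨x, hx⟩ := exists_alternating_cycleType (n := n)
    (m := Multiset.replicate κ.2 κ.1) (by simpa [mul_comm] using hs)
    (fun a ha => Multiset.eq_of_mem_replicate ha ▸ hp.two_le)
    (by simpa using (even_replicate hp).2 he)
  have hx' := elementKey_of_cycleType hk hx
  refine ⟨x, ?_, hx'⟩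
  have : orderOf x = κ.1 := congrArg Prod.fst hx'
  rwa [this]

theorem cycleType_eq_of_elementKey_eq {x y : alternatingGroup (Fin n)}
    (hx : (orderOf x).Prime) (h : elementKey x = elementKey y) :
    (x : Equiv.Perm (Fin n)).cycleType = (y : Equiv.Perm (Fin n)).cycleType := by
  have hy : (orderOf y).Prime := by
    have : orderOf x = orderOf y := congrArg Prod.fst h
    rwa [← this]
  rw [cycleType_eq_of_prime hx, cycleType_eq_of_prime hy, h]

theorem support_subset_of_mem_zpowers {x y : alternatingGroup (Fin n)}
    (h : x ∈ Subgroup.zpowers y) :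
    (x : Equiv.Perm (Fin n)).support ⊆ (y : Equiv.Perm (Fin n)).support := by
  obtain ⟨i, rfl⟩ := h
  exact Equiv.Perm.support_zpow_le _ _

/-- Elements with the same cyclic subgroup have the same order p and the same support, and k is the
size of the support divided by p. -/
theorem elementKey_eq_of_zpowers_eq {x y : alternatingGroup (Fin n)} (hx : (orderOf x).Prime)
    (h : Subgroup.zpowers x = Subgroup.zpowers y) : elementKey x = elementKey y := by
  have ho : orderOf x = orderOf y := by rw [← Nat.card_zpowers, h, Nat.card_zpowers]
  have hy : (orderOf y).Prime := ho ▸ hx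
  have hs : (x : Equiv.Perm (Fin n)).support = (y : Equiv.Perm (Fin n)).support :=
    Finset.Subset.antisymm
      (support_subset_of_mem_zpowers (h ▸ Subgroup.mem_zpowers x))
      (support_subset_of_mem_zpowers (h ▸ Subgroup.mem_zpowers y))
  have h1 := Equiv.Perm.sum_cycleType (x : Equiv.Perm (Fin n))
  rw [hs, ← Equiv.Perm.sum_cycleType, cycleType_eq_of_prime hx, cycleType_eq_of_prime hy] at h1
  simp only [Multiset.sum_replicate, smul_eq_mul] at h1
  refine Prod.ext ho ?_
  have h2 : (elementKey x).1 = (elementKey y).1 := ho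
  rw [h2] at h1
  exact Nat.eq_of_mul_eq_mul_right hy.pos h1

theorem cycleType_pow_of_replicate {g : Equiv.Perm (Fin n)} {p q a b c : ℕ} (hp : p.Prime)
    (hq : q.Prime) (hpq : p ≠ q)
    (h : g.cycleType = Multiset.replicate a p + Multiset.replicate b q +
      Multiset.replicate c (p * q)) :
    (g ^ q).cycleType = Multiset.replicate (a + q * c) p := by
  have h1 : q.gcd p = 1 := (Nat.coprime_primes hq hp).2 hpq.symm
  have h2 : q.gcd q = q := Nat.gcd_self q
  have h3 : q.gcd (p * q) = q := Nat.gcd_eq_left (Dvd.intro_left p rfl)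
  rw [Equiv.Perm.cycleType_pow, h, multisetPower_add, multisetPower_add,
    multisetPower_replicate, multisetPower_replicate, multisetPower_replicate, h1, h2, h3,
    Nat.div_one, Nat.div_self hq.pos, Nat.mul_div_cancel _ hq.pos, Multiset.filter_add,
    Multiset.filter_add]
  have h4 : (Multiset.replicate (b * q) 1).filter (· ≠ 1) = 0 :=
    Multiset.filter_eq_nil.2 fun x hx => by simp [Multiset.eq_of_mem_replicate hx]
  have h5 : ∀ k, (Multiset.replicate k p).filter (· ≠ 1) = Multiset.replicate k p := fun k =>
    Multiset.filter_eq_self.2 fun x hx => Multiset.eq_of_mem_replicate hx ▸ hp.ne_one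
  rw [h4, h5, h5, add_zero, ← Multiset.replicate_add]
  congr 1
  ring

theorem exists_replicate_of_commute {x y : Equiv.Perm (Fin n)} {p q : ℕ}
    (hp : p.Prime) (hq : q.Prime) (hpq : p ≠ q) (hxy : Commute x y) (hx : orderOf x = p)
    (hy : orderOf y = q) : ∃ a b c, (x * y).cycleType = Multiset.replicate a p +
      Multiset.replicate b q + Multiset.replicate c (p * q) := by
  refine ⟨(x * y).cycleType.count p, (x * y).cycleType.count q, (x * y).cycleType.count (p * q),
    ?_⟩
  have hmem : ∀ r ∈ (x * y).cycleType, r = p ∨ r = q ∨ r = p * q := by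
    intro r hr
    have h1 : r ∣ p * q := by
      refine (Equiv.Perm.dvd_of_mem_cycleType hr).trans ?_
      rw [← hx, ← hy]
      exact hxy.orderOf_mul_dvd_mul_orderOf
    have h2 := Equiv.Perm.two_le_of_mem_cycleType hr
    obtain ⟨u, v, hu, hv, rfl⟩ := exists_dvd_and_dvd_of_dvd_mul h1
    rcases (Nat.dvd_prime hp).1 hu with rfl | rfl <;>
      rcases (Nat.dvd_prime hq).1 hv with rfl | rfl <;> simp_all
  have hp1 := hp.one_lt
  have hq1 := hq.one_lt
  have h1 : p ≠ p * q := by nlinarith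
  have h2 : q ≠ p * q := by nlinarith
  ext r
  simp only [Multiset.count_add, Multiset.count_replicate]
  by_cases hr : r ∈ (x * y).cycleType
  · rcases hmem r hr with rfl | rfl | rfl
    · simp [hpq.symm, h1.symm]
    · simp [hpq, h2.symm]
    · simp [h1, h2]
  · rw [Multiset.count_eq_zero_of_notMem hr]
    have h3 : ∀ r', (if r' = r then (x * y).cycleType.count r' else 0) = 0 := by
      intro r'
      split_ifs with h
      · rw [h, Multiset.count_eq_zero_of_notMem hr]
      · rfl
    simp only [h3, add_zero]

/-- An r-cycle contributes r + 1 to the exponent of the sign. When p and q are odd all contributions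
are even. When p = 2 exactly the 2-cycles and the 2q-cycles are odd, hence the condition on a + c;
the case q = 2 is symmetric. -/
theorem even_link {p q a b c : ℕ} (hp : p.Prime) (hq : q.Prime) (hpq : p ≠ q) :
    Even (a * p + b * q + c * (p * q) + (a + b + c)) ↔
      (p = 2 → Even (a + c)) ∧ (q = 2 → Even (b + c)) := by
  rcases hp.eq_two_or_odd' with rfl | h <;> rcases hq.eq_two_or_odd' with rfl | h'
  · exact absurd rfl hpq
  · have : q ≠ 2 := hpq.symm
    have h1 := Nat.not_even_iff_odd.2 h'
    simp only [this, Nat.even_add, Nat.even_mul, h1, even_two]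
    by_cases ha : Even a <;> by_cases hb : Even b <;> by_cases hc : Even c <;> simp [ha, hb, hc]
  · have h1 := Nat.not_even_iff_odd.2 h
    simp only [hpq, Nat.even_add, Nat.even_mul, h1, even_two]
    by_cases ha : Even a <;> by_cases hb : Even b <;> by_cases hc : Even c <;> simp [ha, hb, hc]
  · have h1 := Nat.not_even_iff_odd.2 h
    have h2 := Nat.not_even_iff_odd.2 h'
    have h3 : p ≠ 2 := by rintro rfl; exact h1 even_two
    have h4 : q ≠ 2 := by rintro rfl; exact h2 even_two
    simp only [h3, h4, Nat.even_add, Nat.even_mul, h1, h2]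
    by_cases ha : Even a <;> by_cases hb : Even b <;> by_cases hc : Even c <;> simp [ha, hb, hc]

theorem keyLink_of_commute {x y : alternatingGroup (Fin n)} (hx : (orderOf x).Prime)
    (hy : (orderOf y).Prime) (hne : orderOf x ≠ orderOf y) (hxy : Commute x y) :
    KeyLink n (elementKey x) (elementKey y) := by
  obtain ⟨p, hp⟩ : ∃ p, orderOf x = p := ⟨_, rfl⟩
  obtain ⟨q, hq⟩ : ∃ q, orderOf y = q := ⟨_, rfl⟩
  have hkx := cycleType_eq_of_prime hx
  have hky := cycleType_eq_of_prime hy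
  have h1 : (elementKey x).1 = p := hp
  have h2 : (elementKey y).1 = q := hq
  have hxy' : Commute (x : Equiv.Perm (Fin n)) y := congrArg Subtype.val hxy
  refine ⟨hx, hy, hne, (elementKey_mem_keys hx).2.1, (elementKey_mem_keys hy).2.1, ?_⟩
  rw [hp, hq] at hne
  rw [hp] at hx
  rw [hq] at hy
  rw [h1] at hkx ⊢
  rw [h2] at hky ⊢
  obtain ⟨a, b, c, habc⟩ := exists_replicate_of_commute hx hy hne hxy'
    (by rwa [Subgroup.orderOf_coe]) (by rwa [Subgroup.orderOf_coe])
  refine ⟨a, b, c, ?_, ?_, ?_, ?_⟩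
  -- (xy)^q = x^q has the cycle type of x, as q is prime to p; counting p-cycles in the q-th power
  -- of xy gives k = a + qc.
  · have h3 := cycleType_pow_of_replicate hx hy hne habc
    rw [hxy'.mul_pow, ← hq, ← Subgroup.orderOf_coe, pow_orderOf_eq_one, mul_one,
      Subgroup.orderOf_coe, hq, Equiv.Perm.cycleType_pow, hkx, multisetPower_replicate,
      (Nat.coprime_primes hy hx).2 hne.symm, mul_one, Nat.div_one, Multiset.filter_eq_self.2
        fun x hx' => Multiset.eq_of_mem_replicate hx' ▸ hx.ne_one] at h3
    simpa using congrArg Multiset.card h3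
  · have h3 := cycleType_pow_of_replicate hy hx hne.symm
      (by rw [habc, mul_comm p, add_comm (Multiset.replicate a p)])
    rw [hxy'.mul_pow, ← hp, ← Subgroup.orderOf_coe, pow_orderOf_eq_one, one_mul,
      Subgroup.orderOf_coe, hp, Equiv.Perm.cycleType_pow, hky, multisetPower_replicate,
      (Nat.coprime_primes hx hy).2 hne, mul_one, Nat.div_one, Multiset.filter_eq_self.2
        fun x hx' => Multiset.eq_of_mem_replicate hx' ▸ hy.ne_one] at h3
    simpa using congrArg Multiset.card h3
  · have h3 := Equiv.Perm.sum_cycleType_le ((x : Equiv.Perm (Fin n)) * (y : Equiv.Perm (Fin n)))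
    rw [habc] at h3
    simp only [Multiset.sum_add, Multiset.sum_replicate, smul_eq_mul, Fintype.card_fin] at h3
    linarith
  · have h3 := (even_iff_of_cycleType ((x : Equiv.Perm (Fin n)) * (y : Equiv.Perm (Fin n)))).1 (x * y).2
    rw [habc] at h3
    simp only [Multiset.sum_add, Multiset.sum_replicate, smul_eq_mul, Multiset.card_add,
      Multiset.card_replicate] at h3
    exact (even_link hx hy hne).1 h3

/-- Take w with the prescribed a, b, c cycles; its powers w^q and w^p commute and have the two keys.
-/
theorem exists_commute_of_keyLink {κ κ' : ℕ × ℕ} (h : KeyLink n κ κ') :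
    ∃ x y : alternatingGroup (Fin n), (orderOf x).Prime ∧ (orderOf y).Prime ∧
      orderOf x ≠ orderOf y ∧ Commute x y ∧ elementKey x = κ ∧ elementKey y = κ' := by
  obtain ⟨hp, hq, hne, hk, hl, a, b, c, h1, h2, h3, h4⟩ := h
  obtain ⟨w, hw⟩ := exists_alternating_cycleType (n := n)
    (m := Multiset.replicate a κ.1 + Multiset.replicate b κ'.1 +
      Multiset.replicate c (κ.1 * κ'.1))
    (by
      simp only [Multiset.sum_add, Multiset.sum_replicate, smul_eq_mul]
      linarith)
    (by
      intro r hr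
      simp only [Multiset.mem_add, Multiset.mem_replicate] at hr
      rcases hr with (hr | hr) | hr
      · exact hr.2 ▸ hp.two_le
      · exact hr.2 ▸ hq.two_le
      · rw [hr.2]
        nlinarith [hp.two_le, hq.two_le])
    (by
      simp only [Multiset.sum_add, Multiset.sum_replicate, smul_eq_mul, Multiset.card_add,
        Multiset.card_replicate]
      exact (even_link hp hq hne).2 h4)
  have hx : elementKey (w ^ κ'.1) = κ := by
    refine elementKey_of_cycleType hk ?_
    rw [h1]
    exact cycleType_pow_of_replicate hp hq hne hw
  have hy : elementKey (w ^ κ.1) = κ' := by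
    refine elementKey_of_cycleType hl ?_
    rw [h2]
    exact cycleType_pow_of_replicate hq hp hne.symm
      (by rw [hw, mul_comm κ.1, add_comm (Multiset.replicate a κ.1)])
  have hx1 : orderOf (w ^ κ'.1) = κ.1 := congrArg Prod.fst hx
  have hy1 : orderOf (w ^ κ.1) = κ'.1 := congrArg Prod.fst hy
  exact ⟨_, _, by rwa [hx1], by rwa [hy1], by rwa [hx1, hy1],
    (Commute.refl w).pow_pow _ _, hx, hy⟩

end Keys

/-! ### Components of the type graph and of the order graph -/

section Components

variable {n : ℕ}

/-- A chain of links, read through `f`, is turned into a chain of elements. Each link gives a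
commuting pair, and between pairs one jumps among elements with the same `f`-value, as `r` allows.
`f` is the identity for types and the first projection for orders. -/
theorem eqvGen_of_reflTransGen {δ : Type*} (f : ℕ × ℕ → δ)
    {r : {x : alternatingGroup (Fin n) // x ≠ 1} → {x : alternatingGroup (Fin n) // x ≠ 1} → Prop}
    (hadj : ∀ x y, (properPowerGraph _).Adj x y → r x y)
    (hsame : ∀ x y : {x : alternatingGroup (Fin n) // x ≠ 1}, (orderOf x.1).Prime →
      (orderOf y.1).Prime → f (elementKey x.1) = f (elementKey y.1) → r x y)
    {d : δ} {x y : {x : alternatingGroup (Fin n) // x ≠ 1}} (hx : (orderOf x.1).Prime)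
    (hy : (orderOf y.1).Prime)
    (h : ReflTransGen (Relation.Map (KeyLink n) f f) (f (elementKey x.1)) d)
    (hyd : f (elementKey y.1) = d) : EqvGen r x y := by
  induction h generalizing y with
  | refl => exact EqvGen.rel _ _ (hsame _ _ hx hy hyd.symm)
  | tail _ hl ih =>
    obtain ⟨κ, κ', hl, rfl, rfl⟩ := hl
    obtain ⟨u, v, hu, hv, hne, huv, rfl, rfl⟩ := exists_commute_of_keyLink hl
    have h1 := ih (y := ⟨u, ne_one_of_prime_orderOf hu⟩) hu rfl
    refine EqvGen.trans _ _ _ h1 (EqvGen.trans _ ⟨v, ne_one_of_prime_orderOf hv⟩ _ ?_ ?_)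
    · exact eqvGen_of_powReach hadj (PowReach.of_commute (ne_one_of_prime_orderOf hu)
        (ne_one_of_prime_orderOf hv) huv ((Nat.coprime_primes hu hv).2 hne))
    · exact EqvGen.rel _ _ (hsame _ _ hv hy hyd.symm)

theorem ncard_image_elementKey {γ : Type*} (L : ℕ × ℕ → γ) :
    ((fun x => L (elementKey x)) '' {x : alternatingGroup (Fin n) | (orderOf x).Prime}) =
      L '' keys n := by
  ext z
  constructor
  · rintro ⟨x, hx, rfl⟩
    exact ⟨_, elementKey_mem_keys hx, rfl⟩
  · rintro ⟨κ, hκ, rfl⟩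
    obtain ⟨x, hx, rfl⟩ := exists_elementKey_eq hκ
    exact ⟨x, hx, rfl⟩

theorem primePart_coe {x y : alternatingGroup (Fin n)}
    (h : (x : Equiv.Perm (Fin n)).cycleType = (y : Equiv.Perm (Fin n)).cycleType) :
    ((primePart x : alternatingGroup (Fin n)) : Equiv.Perm (Fin n)).cycleType =
      ((primePart y : alternatingGroup (Fin n)) : Equiv.Perm (Fin n)).cycleType := by
  have ho : orderOf x = orderOf y := by
    rw [← Subgroup.orderOf_coe, ← Subgroup.orderOf_coe, orderOf_eq_of_cycleType_eq h]
  rw [primePart, primePart, ho, Subgroup.coe_pow, Subgroup.coe_pow, Equiv.Perm.cycleType_pow,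
    Equiv.Perm.cycleType_pow, h]

theorem elementKey_eq_of_cycleType_eq {x y : alternatingGroup (Fin n)}
    (h : (x : Equiv.Perm (Fin n)).cycleType = (y : Equiv.Perm (Fin n)).cycleType) :
    elementKey x = elementKey y := by
  rw [elementKey, elementKey, h, ← Subgroup.orderOf_coe, ← Subgroup.orderOf_coe,
    orderOf_eq_of_cycleType_eq h]

theorem numComponents_properPowerTypeGraph {γ : Type*} (L : ℕ × ℕ → γ)
    (hlink : ∀ κ κ', KeyLink n κ κ' → L κ = L κ')
    (hr : ∀ κ ∈ keys n, ∀ κ' ∈ keys n, L κ = L κ' → ReflTransGen (KeyLink n) κ κ') :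
    numComponents (properPowerTypeGraph (alternatingGroup (Fin n))) = (L '' keys n).ncard := by
  let π : {x : alternatingGroup (Fin n) // x ≠ 1} →
      {T : typeSet (alternatingGroup (Fin n)) //
        T ≠ ⟨trivialPartition _, trivialPartition_mem_typeSet _⟩} := fun x =>
    ⟨⟨((x : alternatingGroup (Fin n)) : Equiv.Perm (Fin n)).partition, _, x.1.2, rfl⟩, fun h =>
      x.2 (Subtype.ext (Equiv.Perm.partition_eq_trivialPartition_iff.1 (congrArg Subtype.val h)))⟩
  have hπ : ∀ x y, π x = π y ↔
      ((x : alternatingGroup (Fin n)) : Equiv.Perm (Fin n)).cycleType =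
        ((y : alternatingGroup (Fin n)) : Equiv.Perm (Fin n)).cycleType := by
    intro x y
    rw [← Equiv.Perm.partition_eq_iff, Subtype.ext_iff, Subtype.ext_iff]
  have hsurj : Function.Surjective π := by
    rintro ⟨⟨T, ψ, hψ, rfl⟩, hT⟩
    refine ⟨⟨⟨ψ, hψ⟩, fun h => hT (Subtype.ext ?_)⟩, rfl⟩
    exact Equiv.Perm.partition_eq_trivialPartition_iff.2 (congrArg Subtype.val h)
  have hadj : ∀ u v, (properPowerTypeGraph (alternatingGroup (Fin n))).Adj u v ↔ u ≠ v ∧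
      ((∃ m : ℕ, (u.1 : (Fintype.card (Fin n)).Partition) = partitionPower v.1 m) ∨
        ∃ m : ℕ, (v.1 : (Fintype.card (Fin n)).Partition) = partitionPower u.1 m) := by
    intro u v
    simp [properPowerTypeGraph, vertexDeleted, powerTypeGraph, SimpleGraph.fromRel_adj,
      Subtype.ext_iff]
  rw [← ncard_image_elementKey]
  refine numComponents_eq_ncard_label _ π hsurj ?_ ?_ _ ?_ ?_ ?_ ?_
  · intro x y h
    rw [or_iff_not_imp_left]
    intro hne
    refine (hadj _ _).2 ⟨hne, ?_⟩
    rcases (properPowerGraph_adj.1 h).2 with ⟨m, hm⟩ | ⟨m, hm⟩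
    · refine Or.inl ⟨m, ?_⟩
      simp only [π, hm, Subgroup.coe_pow, Equiv.Perm.partition_pow]
    · refine Or.inr ⟨m, ?_⟩
      simp only [π, hm, Subgroup.coe_pow, Equiv.Perm.partition_pow]
  -- An edge of the type graph lifts: if v is the type of y and u its m-th power, then u is the type
  -- of y^m.
  · have key : ∀ u v, u ≠ v → (∃ m : ℕ, (u.1 : (Fintype.card (Fin n)).Partition) =
        partitionPower v.1 m) → ∃ x y, π x = u ∧ π y = v ∧ (properPowerGraph _).Adj x y := by
      intro u v hne ⟨m, hm⟩
      obtain ⟨y, rfl⟩ := hsurj v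
      have h1 : ((y.1 ^ m : alternatingGroup (Fin n)) : Equiv.Perm (Fin n)).partition = u.1 := by
        rw [hm, Subgroup.coe_pow, Equiv.Perm.partition_pow]
      have h2 : y.1 ^ m ≠ 1 := by
        intro h
        rw [h] at h1
        refine u.2 (Subtype.ext (h1.symm.trans ?_))
        exact Equiv.Perm.partition_eq_trivialPartition_iff.2 rfl
      have h3 : π ⟨y.1 ^ m, h2⟩ = u := Subtype.ext (Subtype.ext h1)
      refine ⟨⟨y.1 ^ m, h2⟩, y, h3, rfl, properPowerGraph_adj.2 ⟨?_, Or.inl ⟨m, rfl⟩⟩⟩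
      rintro h
      exact hne (by rw [← h3, h])
    intro u v h
    obtain ⟨hne, h | h⟩ := (hadj _ _).1 h
    · exact key u v hne h
    · obtain ⟨y, x, hy, hx, hxy⟩ := key v u hne.symm h
      exact ⟨x, y, hx, hy, hxy.symm⟩
  · intro x y hx h
    exact congrArg L (elementKey_eq_of_zpowers_eq hx h)
  · intro x y hxy hx hy hne
    exact hlink _ _ (keyLink_of_commute hx hy hne hxy)
  · intro x y h
    exact congrArg L (elementKey_eq_of_cycleType_eq (primePart_coe ((hπ x y).1 h)))
  · intro x y hx hy h
    refine eqvGen_of_reflTransGen id (fun _ _ => Or.inl) (fun x y hx _ h => Or.inr ((hπ _ _).2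
      (cycleType_eq_of_elementKey_eq hx h))) hx hy ?_ rfl
    rw [Relation.map_id_id]
    exact hr _ (elementKey_mem_keys hx) _ (elementKey_mem_keys hy) h

theorem numComponents_properOrderGraph {γ : Type*} (L : ℕ → γ)
    (hlink : ∀ κ κ', KeyLink n κ κ' → L κ.1 = L κ'.1)
    (hr : ∀ κ ∈ keys n, ∀ κ' ∈ keys n, L κ.1 = L κ'.1 →
      ReflTransGen (Relation.Map (KeyLink n) Prod.fst Prod.fst) κ.1 κ'.1) :
    numComponents (properOrderGraph (alternatingGroup (Fin n))) =
      ((fun κ : ℕ × ℕ => L κ.1) '' keys n).ncard := by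
  let π : {x : alternatingGroup (Fin n) // x ≠ 1} →
      {a : elementOrders (alternatingGroup (Fin n)) // a ≠ ⟨1, one_mem_elementOrders _⟩} :=
    fun x => ⟨⟨orderOf x.1, x.1, rfl⟩, fun h =>
      x.2 (orderOf_eq_one_iff.1 (congrArg Subtype.val h))⟩
  have hπ : ∀ x y, π x = π y ↔ orderOf x.1 = orderOf y.1 := by
    intro x y
    rw [Subtype.ext_iff, Subtype.ext_iff]
  have hsurj : Function.Surjective π := by
    rintro ⟨⟨_, x, rfl⟩, hx⟩
    exact ⟨⟨x, fun h => hx (Subtype.ext (orderOf_eq_one_iff.2 h))⟩, rfl⟩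
  have hadj : ∀ u v, (properOrderGraph (alternatingGroup (Fin n))).Adj u v ↔ u ≠ v ∧
      ((u.1 : ℕ) ∣ v.1 ∨ (v.1 : ℕ) ∣ u.1) := by
    intro u v
    simp [properOrderGraph, vertexDeleted, orderGraph, SimpleGraph.fromRel_adj, Subtype.ext_iff]
  rw [← ncard_image_elementKey]
  refine numComponents_eq_ncard_label _ π hsurj ?_ ?_ _ ?_ ?_ ?_ ?_
  · intro x y h
    rw [or_iff_not_imp_left]
    intro hne
    refine (hadj _ _).2 ⟨hne, ?_⟩
    rcases (properPowerGraph_adj.1 h).2 with ⟨m, hm⟩ | ⟨m, hm⟩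
    · refine Or.inl ?_
      simp only [π, hm]
      exact orderOf_pow_dvd m
    · refine Or.inr ?_
      simp only [π, hm]
      exact orderOf_pow_dvd m
  · have key : ∀ u v, u ≠ v → (u.1 : ℕ) ∣ v.1 →
        ∃ x y, π x = u ∧ π y = v ∧ (properPowerGraph _).Adj x y := by
      intro u v hne hd
      obtain ⟨y, rfl⟩ := hsurj v
      have h0 : 0 < orderOf y.1 := orderOf_pos _
      have hd' : (u.1 : ℕ) ∣ orderOf y.1 := hd
      -- A divisor of the order of y is the order of a power of y, so edges of the order graph lift
      -- as well.
      have h1 : orderOf (y.1 ^ (orderOf y.1 / u.1)) = u.1 := by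
        rw [orderOf_pow_of_dvd, Nat.div_div_self hd' h0.ne']
        · exact (Nat.div_pos (Nat.le_of_dvd h0 hd') (Nat.pos_of_dvd_of_pos hd' h0)).ne'
        · exact Nat.div_dvd_of_dvd hd'
      have h2 : y.1 ^ (orderOf y.1 / u.1) ≠ 1 := by
        intro h
        rw [h, orderOf_one] at h1
        exact u.2 (Subtype.ext h1.symm)
      have h3 : π ⟨_, h2⟩ = u := Subtype.ext (Subtype.ext h1)
      refine ⟨⟨_, h2⟩, y, h3, rfl, properPowerGraph_adj.2 ⟨?_, Or.inl ⟨_, rfl⟩⟩⟩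
      rintro h
      exact hne (by rw [← h3, h])
    intro u v h
    obtain ⟨hne, h | h⟩ := (hadj _ _).1 h
    · exact key u v hne h
    · obtain ⟨y, x, hy, hx, hxy⟩ := key v u hne.symm h
      exact ⟨x, y, hx, hy, hxy.symm⟩
  · intro x y hx h
    exact congrArg (fun κ : ℕ × ℕ => L κ.1) (elementKey_eq_of_zpowers_eq hx h)
  · intro x y hxy hx hy hne
    exact hlink _ _ (keyLink_of_commute hx hy hne hxy)
  · intro x y h
    change L (orderOf (primePart x.1)) = L (orderOf (primePart y.1))
    rw [orderOf_primePart, orderOf_primePart, (hπ x y).1 h]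
  · intro x y hx hy h
    refine eqvGen_of_reflTransGen Prod.fst (fun _ _ => Or.inl)
      (fun x y hx _ h => Or.inr ((hπ _ _).2 h)) hx hy ?_ rfl
    exact hr _ (elementKey_mem_keys hx) _ (elementKey_mem_keys hy) h

end Components

/-! ### Counting subgroups of prime order -/

/-- Each subgroup of order p has p - 1 generators, all of them in `S`. -/
theorem ncard_zpowers_image {G : Type*} [Group G] [Finite G] {S : Set G} {p : ℕ} (hp : p.Prime)
    (hS : ∀ x ∈ S, orderOf x = p)
    (hgen : ∀ x ∈ S, ∀ y, Subgroup.zpowers x = Subgroup.zpowers y → y ∈ S) :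
    (Subgroup.zpowers '' S).ncard * (p - 1) = S.ncard := by
  classical
  have hfin : S.Finite := Set.toFinite S
  rw [Set.ncard_eq_toFinset_card _ hfin, Set.ncard_eq_toFinset_card _ (hfin.image _)]
  rw [Finset.card_eq_sum_card_fiberwise (f := fun x => Subgroup.zpowers x)
    (t := (hfin.image Subgroup.zpowers).toFinset) (fun x hx => by
      simp only [Set.Finite.coe_toFinset] at hx ⊢
      exact ⟨x, hx, rfl⟩), Finset.sum_const_nat]
  intro H hH
  rw [Set.Finite.mem_toFinset] at hH
  obtain ⟨x, hx, rfl⟩ := hH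
  have h1 : (((hfin.toFinset.filter fun y => Subgroup.zpowers y = Subgroup.zpowers x) :
      Finset G) : Set G) = (Subgroup.zpowers x : Set G) \ {1} := by
    ext y
    simp only [Finset.coe_filter, Set.Finite.mem_toFinset, Set.mem_ofPred_eq, Set.mem_sdiff,
      SetLike.mem_coe, Set.mem_singleton_iff]
    constructor
    · rintro ⟨hy, h⟩
      refine ⟨h ▸ Subgroup.mem_zpowers y, ?_⟩
      rintro rfl
      have := hS 1 hy
      rw [orderOf_one] at this
      exact hp.ne_one this.symm
    · rintro ⟨hy, h⟩
      have ho : orderOf y = p := by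
        have h2 := orderOf_dvd_of_mem_zpowers hy
        rw [hS x hx, Nat.dvd_prime hp] at h2
        exact h2.resolve_left fun h3 => h (orderOf_eq_one_iff.1 h3)
      have h2 := zpowers_eq_of_orderOf_eq hy (Subgroup.mem_zpowers x) (ho.trans (hS x hx).symm)
      exact ⟨hgen x hx y h2.symm, h2⟩
  rw [← Set.ncard_coe_finset, h1, Set.ncard_sdiff_singleton_of_mem (Subgroup.one_mem _),
    ← Nat.card_coe_set_eq]
  congr 1
  exact (Nat.card_zpowers x).trans (hS x hx)

/-- The number of subgroups of order `p` in the alternating group of degree `n` which are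
generated by products of `k` disjoint `p`-cycles, for `(p, k)` in `keys n`. -/
noncomputable def subgroupCount (n : ℕ) (κ : ℕ × ℕ) : ℚ :=
  (n.factorial : ℚ) /
    ((κ.1 - 1) * (n - κ.1 * κ.2).factorial * (κ.1 : ℚ) ^ κ.2 * κ.2.factorial)

section Components

variable {n : ℕ}

theorem ncard_zpowers_of_elementKey {κ : ℕ × ℕ} (hκ : κ ∈ keys n) :
    (((Subgroup.zpowers '' {x : alternatingGroup (Fin n) | elementKey x = κ}).ncard : ℕ) : ℚ) =
      subgroupCount n κ := by
  obtain ⟨p, k⟩ := κ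
  obtain ⟨hp, hk, hs, he⟩ := hκ
  dsimp only at hp hk hs he
  have h1 : {x : alternatingGroup (Fin n) | elementKey x = (p, k)} =
      ((Finset.univ.filter fun g : alternatingGroup (Fin n) =>
        (g : Equiv.Perm (Fin n)).cycleType = Multiset.replicate k p : Finset _) : Set _) := by
    ext x
    simp only [Set.mem_ofPred_eq, Finset.coe_filter, Finset.mem_univ, true_and]
    refine ⟨fun h => ?_, fun h => elementKey_of_cycleType hk h⟩
    have ho : orderOf x = p := congrArg Prod.fst h
    rw [cycleType_eq_of_prime (by rwa [ho]), h]
  have h2 := ncard_zpowers_image (S := {x : alternatingGroup (Fin n) | elementKey x = (p, k)}) hp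
    (fun x hx => congrArg Prod.fst hx) (fun x hx y hxy => by
      have ho : orderOf x = p := congrArg Prod.fst hx
      exact (elementKey_eq_of_zpowers_eq (by rwa [ho]) hxy).symm.trans hx)
  nth_rw 2 [h1] at h2
  rw [Set.ncard_coe_finset] at h2
  have h3 := AlternatingGroup.card_of_cycleType_mul_eq (Fin n) (Multiset.replicate k p)
  rw [if_pos, ← h2, Multiset.toFinset_replicate, if_neg hk.ne', Finset.prod_singleton,
    Multiset.count_replicate_self, Multiset.sum_replicate, Multiset.prod_replicate,
    Fintype.card_fin, smul_eq_mul] at h3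
  · have hp1 : (p : ℚ) - 1 ≠ 0 := by
      have : (1 : ℚ) < p := by exact_mod_cast hp.one_lt
      linarith
    have hp0 : (p : ℚ) ≠ 0 := by exact_mod_cast hp.ne_zero
    rw [subgroupCount, ← h3]
    push_cast [Nat.cast_sub hp.one_le]
    have := (n - p * k).factorial_ne_zero
    have := k.factorial_ne_zero
    rw [mul_comm k p]
    field_simp
  · refine ⟨⟨by simpa [mul_comm] using hs, fun a ha => ?_⟩, ?_⟩
    · exact Multiset.eq_of_mem_replicate ha ▸ hp.two_le
    · simpa using (even_replicate hp).2 he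

/-! ### Keys whose elements form part of a single component -/

/-- All elements with key `κ` lie in one component of the proper power graph. -/
def MainKey (n : ℕ) (κ : ℕ × ℕ) : Prop :=
  ∀ x y : alternatingGroup (Fin n), (orderOf x).Prime → elementKey x = κ → elementKey y = κ →
    PowReach x y

/-- A class of the symmetric group may split in the alternating group, so the conjugating
permutation is taken in the full symmetric group; it still induces an automorphism. -/
theorem exists_conjNormal_eq {x y : alternatingGroup (Fin n)} (hx : (orderOf x).Prime)
    (h : elementKey x = elementKey y) :
    ∃ g : Equiv.Perm (Fin n), MulAut.conjNormal g x = y := by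
  obtain ⟨g, hg⟩ := isConj_iff.1
    (Equiv.Perm.isConj_of_cycleType_eq (cycleType_eq_of_elementKey_eq hx h))
  exact ⟨g, Subtype.ext (by rwa [MulAut.conjNormal_apply])⟩

theorem elementKey_conjNormal (g : Equiv.Perm (Fin n)) (x : alternatingGroup (Fin n)) :
    elementKey (MulAut.conjNormal g x) = elementKey x := by
  refine elementKey_eq_of_cycleType_eq ?_
  rw [MulAut.conjNormal_apply, Equiv.Perm.cycleType_conj]

/-- A link is realised by one commuting pair u, v, and conjugating the pair moves v to any
prescribed element with the same key. So it suffices that the key at the start of the chain is main.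
-/
theorem MainKey.powReach {κ κ' : ℕ × ℕ} (hκ : MainKey n κ) (h : ReflTransGen (KeyLink n) κ κ')
    {x y : alternatingGroup (Fin n)} (hx : (orderOf x).Prime) (hxκ : elementKey x = κ)
    (hyκ : elementKey y = κ') : PowReach x y := by
  induction h generalizing x y with
  | refl => exact hκ x y hx hxκ hyκ
  | tail _ hl ih =>
    obtain ⟨u, v, hu, hv, hne, huv, hku, hkv⟩ := exists_commute_of_keyLink hl
    obtain ⟨g, rfl⟩ := exists_conjNormal_eq hv (hkv.trans hyκ.symm)
    refine (ih hx hxκ ((elementKey_conjNormal g u).trans hku)).trans ?_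
    exact (PowReach.of_commute (ne_one_of_prime_orderOf hu)
        (ne_one_of_prime_orderOf hv) huv ((Nat.coprime_primes hu hv).2 hne)).map _

/-- The permutations which preserve the component of `x` in the proper power graph of the
alternating group. -/
def componentStabilizer (x : alternatingGroup (Fin n)) (hx : x ≠ 1) :
    Subgroup (Equiv.Perm (Fin n)) where
  carrier := {g | PowReach (MulAut.conjNormal g x) x}
  one_mem' := by
    have h : MulAut.conjNormal (1 : Equiv.Perm (Fin n)) x = x := by rw [map_one]; rfl
    change PowReach _ _
    rw [h]
    exact PowReach.refl hx
  mul_mem' := by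
    intro g h hg hh
    have h1 : MulAut.conjNormal (g * h) x = MulAut.conjNormal g (MulAut.conjNormal h x) := by
      rw [map_mul]
      rfl
    change PowReach _ _
    rw [h1]
    exact (PowReach.map (MulAut.conjNormal g) hh).trans hg
  inv_mem' := by
    intro g hg
    have h := PowReach.map (MulAut.conjNormal g⁻¹) hg
    rw [← MulAut.mul_apply, ← map_mul, inv_mul_cancel, map_one, MulAut.one_apply] at h
    exact h.symm

/-- Conjugation by g sends the path from x to z to a path from the conjugate of x to z itself. Thus
centralizers of all prime or composite order members of the component lie in the stabilizer. -/
theorem mem_componentStabilizer_of_commute {x z : alternatingGroup (Fin n)} {hx : x ≠ 1}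
    (h : PowReach x z) {g : Equiv.Perm (Fin n)} (hg : Commute g z) :
    g ∈ componentStabilizer x hx := by
  have h1 : MulAut.conjNormal g z = z := by
    refine Subtype.ext ?_
    rw [MulAut.conjNormal_apply, hg.eq, mul_inv_cancel_right]
  have h2 := h.map (MulAut.conjNormal g)
  rw [h1] at h2
  exact h2.trans h.symm

theorem mainKey_of_componentStabilizer_eq_top {x : alternatingGroup (Fin n)}
    (hx : (orderOf x).Prime)
    (h : componentStabilizer x (ne_one_of_prime_orderOf hx) = ⊤) : MainKey n (elementKey x) := by
  have key : ∀ y, elementKey y = elementKey x → PowReach y x := by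
    intro y hy
    obtain ⟨g, rfl⟩ := exists_conjNormal_eq hx hy.symm
    have : g ∈ componentStabilizer x (ne_one_of_prime_orderOf hx) := h ▸ Subgroup.mem_top g
    exact this
  intro y z _ hy hz
  exact (key y hy).trans (key z hz).symm

theorem subgroup_eq_top_of_swap_mem_all {α : Type*} [Finite α] [DecidableEq α]
    {H : Subgroup (Equiv.Perm α)} (h : ∀ i j, i ≠ j → Equiv.swap i j ∈ H) : H = ⊤ := by
  rw [eq_top_iff, ← Equiv.Perm.closure_isSwap, Subgroup.closure_le]
  rintro g ⟨i, j, hij, rfl⟩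
  exact h i j hij

theorem exists_alternating_cycleType_disjoint (s : Finset (Fin n)) {m : Multiset ℕ}
    (hsum : s.card + m.sum ≤ n) (h2 : ∀ a ∈ m, 2 ≤ a) (he : Even (m.sum + Multiset.card m)) :
    ∃ x : alternatingGroup (Fin n), (x : Equiv.Perm (Fin n)).cycleType = m ∧
      Disjoint s (x : Equiv.Perm (Fin n)).support := by
  obtain ⟨g, hg⟩ := (Equiv.Perm.exists_with_cycleType_iff {i : Fin n // i ∉ s}).2
    ⟨by rw [Fintype.card_subtype_compl, Fintype.card_fin, Fintype.card_coe]; omega, h2⟩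
  have h3 : (Equiv.Perm.ofSubtype g).cycleType = m := by
    rw [Equiv.Perm.cycleType_ofSubtype, hg]
  refine ⟨⟨Equiv.Perm.ofSubtype g, (even_iff_of_cycleType _).2 (by rwa [h3])⟩, h3, ?_⟩
  rw [Finset.disjoint_left]
  intro i hi hi'
  rw [Equiv.Perm.mem_support] at hi'
  exact hi' (Equiv.Perm.ofSubtype_apply_of_not_mem g (by simpa using hi))

theorem commute_swap_of_notMem_support {z : Equiv.Perm (Fin n)} {i j : Fin n}
    (hi : i ∉ z.support) (hj : j ∉ z.support) : Commute (Equiv.swap i j) z := by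
  refine (Equiv.Perm.disjoint_iff_disjoint_support.2 ?_).commute
  refine Disjoint.mono_left (b := ({i, j} : Finset (Fin n))) ?_ ?_
  · intro k hk
    rw [Equiv.Perm.mem_support] at hk
    by_contra hk'
    simp only [Finset.mem_insert, Finset.mem_singleton, not_or] at hk'
    exact hk (Equiv.swap_apply_of_ne_of_ne hk'.1 hk'.2)
  · simp [hi, hj]

/-- A transposition disjoint from the 3-cycle x centralizes it. Any other transposition involves,
together with x, at most 4 points, and n ≥ 8 leaves 4 more for a double transposition z which
commutes with both. So every transposition preserves the component of x. -/
theorem mainKey_three (hn : 8 ≤ n) : MainKey n (3, 1) := by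
  obtain ⟨x, hx⟩ := exists_alternating_cycleType (n := n) (m := Multiset.replicate 1 3)
    (by simp; omega) (by simp) (by decide)
  have hκ := elementKey_of_cycleType one_pos hx
  have ho : orderOf x = 3 := congrArg Prod.fst hκ
  have hp : (orderOf x).Prime := ho ▸ Nat.prime_three
  rw [← hκ]
  refine mainKey_of_componentStabilizer_eq_top hp (subgroup_eq_top_of_swap_mem_all ?_)
  intro i j _
  have hcard : (x : Equiv.Perm (Fin n)).support.card = 3 := by
    rw [← Equiv.Perm.sum_cycleType, hx]
    rfl
  by_cases hd : i ∉ (x : Equiv.Perm (Fin n)).support ∧ j ∉ (x : Equiv.Perm (Fin n)).support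
  · exact mem_componentStabilizer_of_commute (PowReach.refl (ne_one_of_prime_orderOf hp))
      (commute_swap_of_notMem_support hd.1 hd.2)
  · have h4 : ((x : Equiv.Perm (Fin n)).support ∪ {i, j}).card ≤ 4 := by
      have key : ∀ a b, a ∈ (x : Equiv.Perm (Fin n)).support →
          ((x : Equiv.Perm (Fin n)).support ∪ {a, b}).card ≤ 4 := by
        intro a b ha
        have : (x : Equiv.Perm (Fin n)).support ∪ {a, b} =
            insert b (x : Equiv.Perm (Fin n)).support := by
          ext k
          simp only [Finset.mem_union, Finset.mem_insert, Finset.mem_singleton]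
          constructor
          · rintro (h | rfl | rfl) <;> simp_all
          · rintro (rfl | h) <;> simp_all
        rw [this]
        exact (Finset.card_insert_le _ _).trans (by rw [hcard])
      by_cases hi : i ∈ (x : Equiv.Perm (Fin n)).support
      · exact key i j hi
      · have hj : j ∈ (x : Equiv.Perm (Fin n)).support := by
          by_contra hj
          exact hd ⟨hi, hj⟩
        rw [Finset.pair_comm]
        exact key j i hj
    obtain ⟨z, hz, hdz⟩ := exists_alternating_cycleType_disjoint
      ((x : Equiv.Perm (Fin n)).support ∪ {i, j}) (m := Multiset.replicate 2 2)
      (by rw [Multiset.sum_replicate, smul_eq_mul]; omega)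
      (fun a ha => (Multiset.eq_of_mem_replicate ha).ge) (by decide)
    have hoz : orderOf z = 2 := congrArg Prod.fst (elementKey_of_cycleType two_pos hz)
    rw [Finset.disjoint_union_left] at hdz
    have hxz : Commute x z := Subtype.ext
      (Equiv.Perm.disjoint_iff_disjoint_support.2 hdz.1).commute
    have hz1 : z ≠ 1 := ne_one_of_prime_orderOf (hoz ▸ Nat.prime_two)
    refine mem_componentStabilizer_of_commute (z := z) (PowReach.of_commute
      (ne_one_of_prime_orderOf hp) hz1 hxz (by rw [ho, hoz]; decide)) ?_
    apply commute_swap_of_notMem_support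
    · exact Finset.disjoint_left.1 hdz.2 (by simp)
    · exact Finset.disjoint_left.1 hdz.2 (by simp)

theorem swap_mem_trans {α : Type*} [DecidableEq α] {H : Subgroup (Equiv.Perm α)} {i j k : α}
    (hij : Equiv.swap i j ∈ H) (hjk : Equiv.swap j k ∈ H) : Equiv.swap i k ∈ H := by
  by_cases h1 : j = k
  · rwa [← h1]
  by_cases h2 : i = k
  · rw [h2, Equiv.swap_self]
    exact H.one_mem
  have h3 : Equiv.swap i k = Equiv.swap i j * Equiv.swap j k * Equiv.swap i j := by
    have h4 := Equiv.swap_apply_apply (Equiv.swap i j) j k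
    rwa [Equiv.swap_apply_right, Equiv.swap_apply_of_ne_of_ne (Ne.symm h2) (Ne.symm h1),
      Equiv.swap_inv] at h4
  rw [h3]
  exact H.mul_mem (H.mul_mem hij hjk) hij

theorem subgroup_eq_top_of_swap_mem_left {α : Type*} [Finite α] [DecidableEq α]
    {H : Subgroup (Equiv.Perm α)} (c : α) (h : ∀ i, Equiv.swap c i ∈ H) : H = ⊤ :=
  subgroup_eq_top_of_swap_mem_all fun i j _ =>
    swap_mem_trans (by rw [Equiv.swap_comm]; exact h i) (h j)

/-- The product of four transpositions. -/
def fourSwaps (a b c d e f g h : Fin n) (hab : a ≠ b) (hcd : c ≠ d) (hef : e ≠ f) (hgh : g ≠ h) :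
    alternatingGroup (Fin n) :=
  ⟨Equiv.swap a b * Equiv.swap c d * Equiv.swap e f * Equiv.swap g h, by
    simp [Equiv.Perm.mem_alternatingGroup, hab, hcd, hef, hgh]⟩

theorem powReach_of_orderOf_three_two {x y : alternatingGroup (Fin n)} (hx : orderOf x = 3)
    (hy : orderOf y = 2) (h : x * y = y * x) : PowReach x y :=
  PowReach.of_commute (ne_one_of_prime_orderOf (hx ▸ Nat.prime_three))
    (ne_one_of_prime_orderOf (hy ▸ Nat.prime_two)) h (by rw [hx, hy]; decide)

theorem elementKey_eq_of_card_support {x : alternatingGroup (Fin n)} {p k : ℕ} (hp : p.Prime)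
    (hx : orderOf x = p) (h : (x : Equiv.Perm (Fin n)).support.card = k * p) :
    elementKey x = (p, k) := by
  refine Prod.ext hx ?_
  rw [← Equiv.Perm.sum_cycleType, cycleType_eq_of_prime (hx ▸ hp), Multiset.sum_replicate,
    smul_eq_mul] at h
  have h1 : (elementKey x).1 = p := hx
  rw [h1] at h
  exact Nat.eq_of_mul_eq_mul_right hp.pos h

/-- No room is left for disjoint elements, so explicit ones are used: t = (0 1 2)(4 5 6) and u = (0
1 3)(4 5 7), with fixed-point-free involutions interchanging their 3-cycles. z commutes with t and
u, z₁ with t, and v with u, so all five lie in one component. -/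
theorem mainKey_three_two_eight : MainKey 8 (3, 2) := by
  let t := fourSwaps (0 : Fin 8) 1 1 2 4 5 5 6 (by decide) (by decide) (by decide) (by decide)
  let u := fourSwaps (0 : Fin 8) 1 1 3 4 5 5 7 (by decide) (by decide) (by decide) (by decide)
  let z := fourSwaps (0 : Fin 8) 4 1 5 2 6 3 7 (by decide) (by decide) (by decide) (by decide)
  let z₁ := fourSwaps (0 : Fin 8) 5 1 6 2 4 3 7 (by decide) (by decide) (by decide) (by decide)
  let v := fourSwaps (0 : Fin 8) 5 1 7 3 4 2 6 (by decide) (by decide) (by decide) (by decide)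
  have ht : orderOf t = 3 := orderOf_eq_prime (Subtype.ext (by decide))
    (fun h => absurd (congrArg (fun x => x.1 0) h) (by decide))
  have hu : orderOf u = 3 := orderOf_eq_prime (Subtype.ext (by decide))
    (fun h => absurd (congrArg (fun x => x.1 0) h) (by decide))
  have hz : orderOf z = 2 := orderOf_eq_prime (Subtype.ext (by decide))
    (fun h => absurd (congrArg (fun x => x.1 0) h) (by decide))
  have hz₁ : orderOf z₁ = 2 := orderOf_eq_prime (Subtype.ext (by decide))
    (fun h => absurd (congrArg (fun x => x.1 0) h) (by decide))
  have hv : orderOf v = 2 := orderOf_eq_prime (Subtype.ext (by decide))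
    (fun h => absurd (congrArg (fun x => x.1 0) h) (by decide))
  have hp : (orderOf t).Prime := ht ▸ Nat.prime_three
  have hκ : elementKey t = (3, 2) := elementKey_eq_of_card_support Nat.prime_three ht (by decide)
  have htz := powReach_of_orderOf_three_two ht hz (by decide)
  have htz₁ := powReach_of_orderOf_three_two ht hz₁ (by decide)
  have htu := htz.trans (powReach_of_orderOf_three_two hu hz (by decide)).symm
  have htv := htu.trans (powReach_of_orderOf_three_two hu hv (by decide))
  rw [← hκ]
  refine mainKey_of_componentStabilizer_eq_top hp (subgroup_eq_top_of_swap_mem_left 0 ?_)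
  have hmem : ∀ {w : alternatingGroup (Fin 8)}, PowReach t w → ∀ i j : Fin 8,
      Equiv.swap i j * (w : Equiv.Perm (Fin 8)) = w * Equiv.swap i j →
      Equiv.swap i j ∈ componentStabilizer t (ne_one_of_prime_orderOf hp) :=
    fun hw _ _ h => mem_componentStabilizer_of_commute hw h
  -- A transposition occurring in z, z₁ or v centralizes that involution. The transpositions used
  -- here connect all the points to 0.
  have h4 := hmem htz 0 4 (by decide)
  have h5 := hmem htz₁ 0 5 (by decide)
  have h1 := swap_mem_trans h5 (hmem htz 5 1 (by decide))
  have h2 := swap_mem_trans h4 (hmem htz₁ 4 2 (by decide))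
  have h6 := swap_mem_trans h2 (hmem htz 2 6 (by decide))
  have h7 := swap_mem_trans h1 (hmem htv 1 7 (by decide))
  have h3 := swap_mem_trans h7 (hmem htz 7 3 (by decide))
  have h0 : Equiv.swap (0 : Fin 8) 0 ∈ componentStabilizer t (ne_one_of_prime_orderOf hp) := by
    rw [Equiv.swap_self]
    exact Subgroup.one_mem _
  intro i
  fin_cases i
  · exact h0
  · exact h1
  · exact h2
  · exact h3
  · exact h4
  · exact h5
  · exact h6
  · exact h7

theorem mainKey_three_two_nine : MainKey 9 (3, 2) := by
  let t := fourSwaps (0 : Fin 9) 1 1 2 4 5 5 6 (by decide) (by decide) (by decide) (by decide)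
  let u := fourSwaps (0 : Fin 9) 1 1 3 4 5 5 7 (by decide) (by decide) (by decide) (by decide)
  let z := fourSwaps (0 : Fin 9) 4 1 5 2 6 3 7 (by decide) (by decide) (by decide) (by decide)
  let z₁ := fourSwaps (0 : Fin 9) 5 1 6 2 4 3 7 (by decide) (by decide) (by decide) (by decide)
  let v := fourSwaps (0 : Fin 9) 5 1 7 3 4 2 6 (by decide) (by decide) (by decide) (by decide)
  have ht : orderOf t = 3 := orderOf_eq_prime (Subtype.ext (by decide))
    (fun h => absurd (congrArg (fun x => x.1 0) h) (by decide))
  have hu : orderOf u = 3 := orderOf_eq_prime (Subtype.ext (by decide))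
    (fun h => absurd (congrArg (fun x => x.1 0) h) (by decide))
  have hz : orderOf z = 2 := orderOf_eq_prime (Subtype.ext (by decide))
    (fun h => absurd (congrArg (fun x => x.1 0) h) (by decide))
  have hz₁ : orderOf z₁ = 2 := orderOf_eq_prime (Subtype.ext (by decide))
    (fun h => absurd (congrArg (fun x => x.1 0) h) (by decide))
  have hv : orderOf v = 2 := orderOf_eq_prime (Subtype.ext (by decide))
    (fun h => absurd (congrArg (fun x => x.1 0) h) (by decide))
  have hp : (orderOf t).Prime := ht ▸ Nat.prime_three
  have hκ : elementKey t = (3, 2) := elementKey_eq_of_card_support Nat.prime_three ht (by decide)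
  have htz := powReach_of_orderOf_three_two ht hz (by decide)
  have htz₁ := powReach_of_orderOf_three_two ht hz₁ (by decide)
  have htu := htz.trans (powReach_of_orderOf_three_two hu hz (by decide)).symm
  have htv := htu.trans (powReach_of_orderOf_three_two hu hv (by decide))
  rw [← hκ]
  refine mainKey_of_componentStabilizer_eq_top hp (subgroup_eq_top_of_swap_mem_left 0 ?_)
  have hmem : ∀ {w : alternatingGroup (Fin 9)}, PowReach t w → ∀ i j : Fin 9,
      Equiv.swap i j * (w : Equiv.Perm (Fin 9)) = w * Equiv.swap i j →
      Equiv.swap i j ∈ componentStabilizer t (ne_one_of_prime_orderOf hp) :=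
    fun hw _ _ h => mem_componentStabilizer_of_commute hw h
  have h4 := hmem htz 0 4 (by decide)
  have h5 := hmem htz₁ 0 5 (by decide)
  have h1 := swap_mem_trans h5 (hmem htz 5 1 (by decide))
  have h2 := swap_mem_trans h4 (hmem htz₁ 4 2 (by decide))
  have h6 := swap_mem_trans h2 (hmem htz 2 6 (by decide))
  have h7 := swap_mem_trans h1 (hmem htv 1 7 (by decide))
  have h3 := swap_mem_trans h7 (hmem htz 7 3 (by decide))
  -- The ninth point is reached because t fixes both 7 and 8.
  have h8 := swap_mem_trans h7 (hmem (PowReach.refl (ne_one_of_prime_orderOf hp)) 7 8 (by decide))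
  have h0 : Equiv.swap (0 : Fin 9) 0 ∈ componentStabilizer t (ne_one_of_prime_orderOf hp) := by
    rw [Equiv.swap_self]
    exact Subgroup.one_mem _
  intro i
  fin_cases i
  · exact h0
  · exact h1
  · exact h2
  · exact h3
  · exact h4
  · exact h5
  · exact h6
  · exact h7
  · exact h8

end Components

/-! ### Classifications of keys and what they count -/

/-- A division of `keys n` into isolated keys `I` and classes with representatives in `M`, such
that `μ` assigns to a key which is not isolated the representative of its class. -/
structure KeyClassification (n : ℕ) (M I : Finset (ℕ × ℕ)) (μ : ℕ × ℕ → ℕ × ℕ) : Prop where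
  isolated : ∀ κ ∈ I, κ ∈ keys n ∧ ∀ κ', ¬ KeyLink n κ κ'
  main : ∀ m ∈ M, m ∈ keys n ∧ m ∉ I ∧ μ m = m
  link : ∀ κ κ', KeyLink n κ κ' → μ κ = μ κ'
  reach : ∀ κ ∈ keys n, κ ∉ I → μ κ ∈ M ∧ ReflTransGen (KeyLink n) (μ κ) κ

theorem reflTransGen_keyLink_symm {n : ℕ} {κ κ' : ℕ × ℕ}
    (h : ReflTransGen (KeyLink n) κ κ') : ReflTransGen (KeyLink n) κ' κ := by
  induction h with
  | refl => exact ReflTransGen.refl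
  | tail _ hl ih => exact ReflTransGen.head hl.symm ih

namespace KeyClassification

variable {n : ℕ} {M I : Finset (ℕ × ℕ)} {μ : ℕ × ℕ → ℕ × ℕ}

theorem notMem_of_link (h : KeyClassification n M I μ) {κ κ' : ℕ × ℕ} (hl : KeyLink n κ κ') :
    κ ∉ I :=
  fun hκ => (h.isolated κ hκ).2 κ' hl

theorem reach_of_eq (h : KeyClassification n M I μ) {κ κ' : ℕ × ℕ} (hκ : κ ∈ keys n)
    (hκI : κ ∉ I) (hκ' : κ' ∈ keys n) (hκI' : κ' ∉ I) (he : μ κ = μ κ') :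
    ReflTransGen (KeyLink n) κ κ' := by
  have h1 := reflTransGen_keyLink_symm (h.reach κ hκ hκI).2
  rw [he] at h1
  exact h1.trans (h.reach κ' hκ' hκI').2

theorem numComponents_type (h : KeyClassification n M I μ) :
    numComponents (properPowerTypeGraph (alternatingGroup (Fin n))) = M.card + I.card := by
  rw [numComponents_properPowerTypeGraph (fun κ => if κ ∈ I then κ else μ κ)]
  · have h1 : ((fun κ => if κ ∈ I then κ else μ κ) '' keys n) = ((M ∪ I : Finset _) : Set _) := by
      ext z
      simp only [Set.mem_image, Finset.mem_coe, Finset.mem_union]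
      constructor
      · rintro ⟨κ, hκ, rfl⟩
        split_ifs with hI
        · exact Or.inr hI
        · exact Or.inl (h.reach κ hκ hI).1
      · rintro (hz | hz)
        · exact ⟨z, (h.main z hz).1, by rw [if_neg (h.main z hz).2.1, (h.main z hz).2.2]⟩
        · exact ⟨z, (h.isolated z hz).1, if_pos hz⟩
    rw [h1, Set.ncard_coe_finset, Finset.card_union_of_disjoint]
    exact Finset.disjoint_left.2 fun m hm => (h.main m hm).2.1
  · intro κ κ' hl
    rw [if_neg (h.notMem_of_link hl), if_neg (h.notMem_of_link hl.symm), h.link κ κ' hl]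
  · intro κ hκ κ' hκ' he
    split_ifs at he with h1 h2 h2
    · rw [he]
    · exact absurd h1 (he ▸ (h.main _ (h.reach κ' hκ' h2).1).2.1)
    · exact absurd h2 (he ▸ (h.main _ (h.reach κ hκ h1).1).2.1)
    · exact h.reach_of_eq hκ h1 hκ' h2 he

/-- `J` is the set of primes all of whose keys are isolated; each is a component of its own. Every
other prime has a key linked to a representative, and all representatives have prime 3, so they
merge into one component, which is absent exactly when `M` is empty. -/
theorem numComponents_order (h : KeyClassification n M I μ) {J : Finset ℕ}
    (hM : ∀ m ∈ M, m.1 = 3)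
    (hJ : ∀ p ∈ J, ∃ k, (p, k) ∈ keys n)
    (hJI : ∀ κ ∈ keys n, κ.1 ∈ J → κ ∈ I)
    (hIJ : ∀ κ ∈ I, κ.1 ∈ J ∨ ∃ k, (κ.1, k) ∈ keys n ∧ (κ.1, k) ∉ I) :
    numComponents (properOrderGraph (alternatingGroup (Fin n))) =
      (M.image Prod.fst).card + J.card := by
  have hM3 : ∀ p, p ∈ M.image Prod.fst → p = 3 ∧ p ∉ J := by
    intro p hp
    obtain ⟨m, hm, rfl⟩ := Finset.mem_image.1 hp
    exact ⟨hM m hm, fun h1 => (h.main m hm).2.1 (hJI m (h.main m hm).1 h1)⟩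
  have hreach : ∀ κ ∈ keys n, κ.1 ∉ J → 3 ∈ M.image Prod.fst ∧
      ReflTransGen (Relation.Map (KeyLink n) Prod.fst Prod.fst) 3 κ.1 := by
    have key : ∀ κ ∈ keys n, κ ∉ I → 3 ∈ M.image Prod.fst ∧
        ReflTransGen (Relation.Map (KeyLink n) Prod.fst Prod.fst) 3 κ.1 := by
      intro κ hκ hI
      obtain ⟨h1, h2⟩ := h.reach κ hκ hI
      refine ⟨Finset.mem_image.2 ⟨_, h1, hM _ h1⟩, ?_⟩
      rw [← hM _ h1]
      exact ReflTransGen.lift (p := Relation.Map (KeyLink n) Prod.fst Prod.fst)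
        (fun κ : ℕ × ℕ => κ.1) (fun a b hab => ⟨a, b, hab, rfl, rfl⟩) _ _ h2
    intro κ hκ hκJ
    by_cases hI : κ ∈ I
    · obtain ⟨k, hk, hkI⟩ := (hIJ κ hI).resolve_left hκJ
      exact key (κ.1, k) hk hkI
    · exact key κ hκ hI
  have hsymm : ∀ {p q}, ReflTransGen (Relation.Map (KeyLink n) Prod.fst Prod.fst) p q →
      ReflTransGen (Relation.Map (KeyLink n) Prod.fst Prod.fst) q p := by
    intro p q hpq
    induction hpq with
    | refl => exact ReflTransGen.refl
    | tail _ hl ih =>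
      obtain ⟨κ, κ', hl, h1, h2⟩ := hl
      exact ReflTransGen.head ⟨κ', κ, hl.symm, h2, h1⟩ ih
  rw [numComponents_properOrderGraph (fun p => if p ∈ J then p else 3)]
  · have h1 : ((fun κ : ℕ × ℕ => if κ.1 ∈ J then κ.1 else 3) '' keys n) =
        ((M.image Prod.fst ∪ J : Finset _) : Set _) := by
      ext z
      simp only [Set.mem_image, Finset.mem_coe, Finset.mem_union]
      constructor
      · rintro ⟨κ, hκ, rfl⟩
        split_ifs with hI
        · exact Or.inr hI
        · exact Or.inl (hreach κ hκ hI).1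
      · rintro (hz | hz)
        · have hz' := hM3 z hz
          obtain ⟨m, hm, rfl⟩ := Finset.mem_image.1 hz
          exact ⟨m, (h.main m hm).1, by rw [if_neg hz'.2, hz'.1]⟩
        · obtain ⟨k, hk⟩ := hJ z hz
          exact ⟨(z, k), hk, if_pos hz⟩
    rw [h1, Set.ncard_coe_finset, Finset.card_union_of_disjoint]
    exact Finset.disjoint_left.2 fun p hp => (hM3 p hp).2
  · intro κ κ' hl
    rw [if_neg fun h1 => h.notMem_of_link hl (hJI κ hl.mem_left h1),
      if_neg fun h1 => h.notMem_of_link hl.symm (hJI κ' hl.mem_right h1)]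
  · intro κ hκ κ' hκ' he
    split_ifs at he with h1 h2 h2
    · rw [he]
    · exact absurd h1 (he ▸ (hM3 3 (hreach κ' hκ' h2).1).2)
    · exact absurd h2 (he ▸ (hM3 3 (hreach κ hκ h1).1).2)
    · exact (hsymm (hreach κ hκ h1).2).trans (hreach κ' hκ' h2).2

end KeyClassification

/-! ### Components of the power graph of the alternating group -/

section PowerCount

variable {n : ℕ}

theorem prime_orderOf_of_elementKey_mem {x : alternatingGroup (Fin n)}
    (h : elementKey x ∈ keys n) : (orderOf x).Prime :=
  h.1

theorem ncard_zpowers_of_elementKey_mem {I : Finset (ℕ × ℕ)} (hI : ∀ κ ∈ I, κ ∈ keys n) :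
    (((Subgroup.zpowers '' {x : alternatingGroup (Fin n) | elementKey x ∈ I}).ncard : ℕ) : ℚ) =
      ∑ κ ∈ I, subgroupCount n κ := by
  induction I using Finset.induction_on with
  | empty => simp
  | insert κ I hκ ih =>
    have h1 : Subgroup.zpowers '' {x : alternatingGroup (Fin n) | elementKey x ∈ insert κ I} =
        Subgroup.zpowers '' {x : alternatingGroup (Fin n) | elementKey x = κ} ∪
          Subgroup.zpowers '' {x : alternatingGroup (Fin n) | elementKey x ∈ I} := by
      rw [← Set.image_union]
      congr 1
      ext x
      simp
    rw [h1, Set.ncard_union_eq, Nat.cast_add, Finset.sum_insert hκ,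
      ncard_zpowers_of_elementKey (hI κ (Finset.mem_insert_self _ _)),
      ih fun κ' h => hI κ' (Finset.mem_insert_of_mem h)]
    rw [Set.disjoint_left]
    rintro _ ⟨x, rfl, rfl⟩ ⟨y, hy, hxy⟩
    have hy' : elementKey y ∈ I := hy
    rw [elementKey_eq_of_zpowers_eq
      (prime_orderOf_of_elementKey_mem (hI _ (Finset.mem_insert_of_mem hy'))) hxy] at hy'
    exact hκ hy'

/-- An element with isolated key is labelled by its cyclic subgroup, any other by `L`; the two kinds
of label are kept apart by a sum type. `L` is left free because in degree 7 it is not a function of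
the key. -/
theorem numComponents_properPowerGraph_alternating {γ : Type*} {I : Finset (ℕ × ℕ)}
    (hI : ∀ κ ∈ I, κ ∈ keys n ∧ ∀ κ', ¬ KeyLink n κ κ') (L : alternatingGroup (Fin n) → γ)
    (hL : ∀ x y, elementKey x ∈ keys n → elementKey y ∈ keys n → elementKey x ∉ I →
      elementKey y ∉ I → orderOf x ≠ orderOf y → Commute x y → L x = L y)
    (hcyc : ∀ x y, elementKey x ∈ keys n → elementKey x ∉ I →
      Subgroup.zpowers x = Subgroup.zpowers y → L x = L y)
    (hr : ∀ x y, elementKey x ∈ keys n → elementKey y ∈ keys n → elementKey x ∉ I →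
      elementKey y ∉ I → L x = L y → PowReach x y)
    (hfin : (L '' {x | elementKey x ∈ keys n ∧ elementKey x ∉ I}).Finite) :
    (numComponents (properPowerGraph (alternatingGroup (Fin n))) : ℚ) =
      (L '' {x | elementKey x ∈ keys n ∧ elementKey x ∉ I}).ncard +
        ∑ κ ∈ I, subgroupCount n κ := by
  classical
  rw [numComponents_properPowerGraph (G := alternatingGroup (Fin n))
    (fun x => if elementKey x ∈ I then Sum.inr (Subgroup.zpowers x) else Sum.inl (L x))]
  · have h1 : (fun x => if elementKey x ∈ I then Sum.inr (Subgroup.zpowers x) else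
        Sum.inl (L x)) '' {x : alternatingGroup (Fin n) | (orderOf x).Prime} =
        Sum.inl '' (L '' {x | elementKey x ∈ keys n ∧ elementKey x ∉ I}) ∪
        Sum.inr '' (Subgroup.zpowers ''
          {x : alternatingGroup (Fin n) | elementKey x ∈ I}) := by
      ext z
      constructor
      · rintro ⟨x, hx, rfl⟩
        dsimp only
        split_ifs with h
        · exact Or.inr ⟨_, ⟨x, h, rfl⟩, rfl⟩
        · exact Or.inl ⟨_, ⟨x, ⟨elementKey_mem_keys hx, h⟩, rfl⟩, rfl⟩
      · rintro (⟨_, ⟨x, ⟨hx, hxI⟩, rfl⟩, rfl⟩ | ⟨_, ⟨x, hx, rfl⟩, rfl⟩)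
        · exact ⟨x, prime_orderOf_of_elementKey_mem hx, if_neg hxI⟩
        · exact ⟨x, prime_orderOf_of_elementKey_mem (hI _ hx).1, if_pos hx⟩
    rw [h1, Set.ncard_union_eq ?_ (hfin.image _) (Set.toFinite _),
      Set.ncard_image_of_injective _ Sum.inl_injective,
      Set.ncard_image_of_injective _ Sum.inr_injective, Nat.cast_add,
      ncard_zpowers_of_elementKey_mem fun κ h => (hI κ h).1]
    rw [Set.disjoint_left]
    rintro _ ⟨x, _, rfl⟩ ⟨y, _, hy⟩
    exact Sum.inr_ne_inl hy
  · intro x y hx h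
    have hk := elementKey_eq_of_zpowers_eq hx h
    simp only [← hk]
    split_ifs with hxI
    · rw [h]
    · rw [hcyc x y (elementKey_mem_keys hx) hxI h]
  · intro x y hxy hx hy hne
    have hl := keyLink_of_commute hx hy hne hxy
    have h1 : elementKey x ∉ I := fun h => (hI _ h).2 _ hl
    have h2 : elementKey y ∉ I := fun h => (hI _ h).2 _ hl.symm
    simp only [h1, h2, if_false]
    rw [hL x y (elementKey_mem_keys hx) (elementKey_mem_keys hy) h1 h2 hne hxy]
  · intro x y hx hy h
    split_ifs at h with h1 h2 h2
    · exact PowReach.of_zpowers_eq (ne_one_of_prime_orderOf hx) (Sum.inr_injective h)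
    · exact hr x y (elementKey_mem_keys hx) (elementKey_mem_keys hy) h1 h2
        (Sum.inl_injective h)

theorem KeyClassification.numComponents_power {M I : Finset (ℕ × ℕ)} {μ : ℕ × ℕ → ℕ × ℕ}
    (h : KeyClassification n M I μ) (hM : ∀ m ∈ M, MainKey n m) :
    (numComponents (properPowerGraph (alternatingGroup (Fin n))) : ℚ) =
      M.card + ∑ κ ∈ I, subgroupCount n κ := by
  have h1 : (fun x : alternatingGroup (Fin n) => μ (elementKey x)) ''
      {x | elementKey x ∈ keys n ∧ elementKey x ∉ I} = (M : Set (ℕ × ℕ)) := by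
    ext m
    constructor
    · rintro ⟨x, ⟨hx, hxI⟩, rfl⟩
      exact (h.reach _ hx hxI).1
    · intro hm
      obtain ⟨x, -, hx⟩ := exists_elementKey_eq (h.main m hm).1
      refine ⟨x, ?_, ?_⟩
      · rw [Set.mem_ofPred_eq, hx]
        exact ⟨(h.main m hm).1, (h.main m hm).2.1⟩
      · dsimp only
        rw [hx, (h.main m hm).2.2]
  rw [numComponents_properPowerGraph_alternating h.isolated (fun x => μ (elementKey x)), h1,
    Set.ncard_coe_finset]
  · intro x y hx hy _ _ hne hxy
    exact h.link _ _ (keyLink_of_commute (prime_orderOf_of_elementKey_mem hx)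
      (prime_orderOf_of_elementKey_mem hy) hne hxy)
  · intro x y hx _ hxy
    exact congrArg μ (elementKey_eq_of_zpowers_eq (prime_orderOf_of_elementKey_mem hx) hxy)
  · intro x y hx hy hxI hyI hxy
    obtain ⟨hm, hrx⟩ := h.reach _ hx hxI
    have hry := (h.reach _ hy hyI).2
    rw [← hxy] at hry
    obtain ⟨m, hm1, hm2⟩ := exists_elementKey_eq (h.main _ hm).1
    exact ((hM _ hm).powReach hrx hm1 hm2 rfl).symm.trans ((hM _ hm).powReach hry hm1 hm2 rfl)
  · rw [h1]
    exact M.finite_toSet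

theorem KeyClassification.altCounts {M I : Finset (ℕ × ℕ)} {μ : ℕ × ℕ → ℕ × ℕ} {J : Finset ℕ}
    (h : KeyClassification n M I μ) {c : ℚ} {t o : ℕ}
    (hP : (numComponents (properPowerGraph (alternatingGroup (Fin n))) : ℚ) = c)
    (ht : M.card + I.card = t) (hM : ∀ m ∈ M, m.1 = 3)
    (hJ : ∀ p ∈ J, ∃ k, (p, k) ∈ keys n) (hJI : ∀ κ ∈ keys n, κ.1 ∈ J → κ ∈ I)
    (hIJ : ∀ κ ∈ I, κ.1 ∈ J ∨ ∃ k, (κ.1, k) ∈ keys n ∧ (κ.1, k) ∉ I)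
    (ho : (M.image Prod.fst).card + J.card = o) : AltCounts n c t o := by
  refine ⟨hP, ?_, ?_, ?_⟩
  · rw [← numComponents_properQuotientPowerGraph]
    exact hP
  · rw [h.numComponents_type, ht]
  · rw [h.numComponents_order hM hJ hJI hIJ, ho]

theorem altCounts_of_isolated {I : Finset (ℕ × ℕ)} (hI : ∀ κ, κ ∈ I ↔ κ ∈ keys n)
    (hno : ∀ κ ∈ I, ∀ κ', ¬ KeyLink n κ κ') {c : ℚ} {t o : ℕ}
    (hc : ∑ κ ∈ I, subgroupCount n κ = c) (ht : I.card = t)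
    (ho : (I.image Prod.fst).card = o) : AltCounts n c t o := by
  -- With no links at all there are no representatives, and every prime that occurs belongs to `J`.
  have h : KeyClassification n ∅ I id :=
    { isolated := fun κ hκ => ⟨(hI κ).1 hκ, hno κ hκ⟩
      main := fun m hm => absurd hm (Finset.notMem_empty m)
      link := fun κ κ' hl => absurd hl (hno κ ((hI κ).2 hl.mem_left) κ')
      reach := fun κ hκ hκI => absurd ((hI κ).2 hκ) hκI }
  refine h.altCounts (J := I.image Prod.fst) ?_ (by simpa using ht) (by simp) ?_ ?_ ?_
    (by simpa using ho)
  · rw [h.numComponents_power (by simp), hc]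
    simp
  · intro p hp
    obtain ⟨κ, hκ, rfl⟩ := Finset.mem_image.1 hp
    exact ⟨κ.2, (hI κ).1 hκ⟩
  · exact fun κ hκ _ => (hI κ).2 hκ
  · exact fun κ hκ => Or.inl (Finset.mem_image_of_mem _ hκ)

end PowerCount

/-! ### Degree 7: one component for each 3-subset -/

section SevenPoints

theorem exists_disjoint_of_key (x : alternatingGroup (Fin 7)) (p k q l : ℕ)
    (hs : k * p + l * q = 7) (hq : q.Prime) (hl : 0 < l) (he : q = 2 → Even l)
    (hx : (x : Equiv.Perm (Fin 7)).support.card = k * p) :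
    ∃ z : alternatingGroup (Fin 7), orderOf z = q ∧ elementKey z = (q, l) ∧
      (z : Equiv.Perm (Fin 7)).support = (x : Equiv.Perm (Fin 7)).supportᶜ := by
  obtain ⟨z, hz, hd⟩ := exists_alternating_cycleType_disjoint
    (x : Equiv.Perm (Fin 7)).support (m := Multiset.replicate l q)
    (by rw [Multiset.sum_replicate, smul_eq_mul, hx, hs])
    (fun a ha => Multiset.eq_of_mem_replicate ha ▸ hq.two_le)
    (by simpa using (even_replicate hq).2 he)
  have hk := elementKey_of_cycleType hl hz
  refine ⟨z, congrArg Prod.fst hk, hk, ?_⟩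
  refine Finset.eq_of_subset_of_card_le ?_ ?_
  · rw [Finset.subset_compl_iff_disjoint_left]
    exact hd
  · rw [Finset.card_compl, Fintype.card_fin, hx, ← Equiv.Perm.sum_cycleType, hz,
      Multiset.sum_replicate, smul_eq_mul]
    omega

theorem card_support_of_elementKey {n : ℕ} {x : alternatingGroup (Fin n)} {p k : ℕ}
    (hp : p.Prime) (h : elementKey x = (p, k)) :
    (x : Equiv.Perm (Fin n)).support.card = k * p := by
  have ho : orderOf x = p := congrArg Prod.fst h
  rw [← Equiv.Perm.sum_cycleType, cycleType_eq_of_prime (ho ▸ hp), h, Multiset.sum_replicate,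
    smul_eq_mul]

theorem powReach_of_support_compl {x y : alternatingGroup (Fin 7)}
    (hx : orderOf x = 3) (hy : orderOf y = 2)
    (h : (x : Equiv.Perm (Fin 7)).support = (y : Equiv.Perm (Fin 7)).supportᶜ) :
    PowReach x y := by
  refine powReach_of_orderOf_three_two hx hy (Subtype.ext ?_)
  refine (Equiv.Perm.disjoint_iff_disjoint_support.2 ?_).commute
  rw [h]
  exact disjoint_compl_left

/-- An involution y commuting with a 3-cycle x cannot move a point i of the support of x: y would
send i to x^j i, so x^(2j) fixes i, hence 3 ∣ j and y i = i. The supports are disjoint, and 3 + 4 =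
7. -/
theorem support_eq_compl_of_commute {x y : alternatingGroup (Fin 7)}
    (hx : elementKey x = (3, 1)) (hy : elementKey y = (2, 2)) (hxy : Commute x y) :
    (x : Equiv.Perm (Fin 7)).support = (y : Equiv.Perm (Fin 7)).supportᶜ := by
  have hox : orderOf x = 3 := congrArg Prod.fst hx
  have hoy : orderOf y = 2 := congrArg Prod.fst hy
  have hcx := card_support_of_elementKey Nat.prime_three hx
  have hcy := card_support_of_elementKey Nat.prime_two hy
  have hxy' : Commute (x : Equiv.Perm (Fin 7)) y := congrArg Subtype.val hxy
  have hdisj : Disjoint (x : Equiv.Perm (Fin 7)).support (y : Equiv.Perm (Fin 7)).support := by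
    rw [Finset.disjoint_left]
    intro i hi hiy
    have h3 : (x : Equiv.Perm (Fin 7)).IsThreeCycle := card_support_eq_three_iff.1 hcx
    rw [Equiv.Perm.mem_support] at hi hiy
    have hyi : (x : Equiv.Perm (Fin 7)) ((y : Equiv.Perm (Fin 7)) i) ≠
        (y : Equiv.Perm (Fin 7)) i := by
      rw [← Equiv.Perm.mul_apply, hxy'.eq, Equiv.Perm.mul_apply]
      exact fun h => hi ((y : Equiv.Perm (Fin 7)).injective h)
    obtain ⟨j, hj⟩ := h3.isCycle.exists_pow_eq hi hyi
    have hy2 : (y : Equiv.Perm (Fin 7)) ((y : Equiv.Perm (Fin 7)) i) = i := by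
      have h4 : (y : Equiv.Perm (Fin 7)) ^ 2 = 1 := by
        rw [← hoy, ← Subgroup.orderOf_coe, pow_orderOf_eq_one]
      rw [← Equiv.Perm.mul_apply, ← pow_two, h4, Equiv.Perm.one_apply]
    have h5 : ((x : Equiv.Perm (Fin 7)) ^ (j * 2)) i = i := by
      rw [mul_two, pow_add, Equiv.Perm.mul_apply, hj, ← Equiv.Perm.mul_apply,
        (hxy'.pow_left j).eq, Equiv.Perm.mul_apply, hj, hy2]
    have h6 := h3.isCycle.pow_eq_one_iff.2 ⟨i, hi, h5⟩
    rw [← orderOf_dvd_iff_pow_eq_one, h3.orderOf] at h6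
    have h7 : (x : Equiv.Perm (Fin 7)) ^ j = 1 := by
      rw [← orderOf_dvd_iff_pow_eq_one, h3.orderOf]
      omega
    rw [h7, Equiv.Perm.one_apply] at hj
    exact hiy hj.symm
  refine Finset.eq_of_subset_of_card_le ?_ ?_
  · rw [Finset.subset_compl_iff_disjoint_left]
    exact hdisj.symm
  · rw [Finset.card_compl, hcx, hcy, Fintype.card_fin]

/-- The label is the support of a 3-cycle, or the complement of the support of a double
transposition. Commuting pairs share it, and it takes all 7 choose 3 = 35 values. -/
theorem numComponents_properPowerGraph_seven {I : Finset (ℕ × ℕ)}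
    (hI : ∀ κ ∈ I, κ ∈ keys 7 ∧ ∀ κ', ¬ KeyLink 7 κ κ')
    (hmain : ∀ κ, (κ ∈ keys 7 ∧ κ ∉ I) ↔ κ = (3, 1) ∨ κ = (2, 2)) :
    (numComponents (properPowerGraph (alternatingGroup (Fin 7))) : ℚ) =
      35 + ∑ κ ∈ I, subgroupCount 7 κ := by
  have hkey : ∀ x : alternatingGroup (Fin 7), elementKey x ∈ keys 7 → elementKey x ∉ I →
      elementKey x = (3, 1) ∨ elementKey x = (2, 2) := fun x h1 h2 => (hmain _).1 ⟨h1, h2⟩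
  let L : alternatingGroup (Fin 7) → Finset (Fin 7) := fun x =>
    if elementKey x = (3, 1) then (x : Equiv.Perm (Fin 7)).support
    else (x : Equiv.Perm (Fin 7)).supportᶜ
  have hL3 : ∀ x, elementKey x = (3, 1) → L x = (x : Equiv.Perm (Fin 7)).support :=
    fun x h => if_pos h
  have hL2 : ∀ x, elementKey x = (2, 2) → L x = (x : Equiv.Perm (Fin 7)).supportᶜ :=
    fun x h => if_neg (by rw [h]; decide)
  have himg : L '' {x | elementKey x ∈ keys 7 ∧ elementKey x ∉ I} =
      ((Finset.powersetCard 3 (Finset.univ : Finset (Fin 7)) : Finset _) : Set _) := by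
    ext s
    simp only [Finset.mem_coe, Finset.mem_powersetCard, Finset.subset_univ, true_and]
    constructor
    · rintro ⟨x, ⟨hx, hxI⟩, rfl⟩
      rcases hkey x hx hxI with h | h
      · rw [hL3 x h, card_support_of_elementKey Nat.prime_three h]
      · rw [hL2 x h, Finset.card_compl, card_support_of_elementKey Nat.prime_two h,
          Fintype.card_fin]
    · intro hs
      obtain ⟨z, hz, hd⟩ := exists_alternating_cycleType_disjoint
        sᶜ (m := Multiset.replicate 1 3)
        (by rw [Finset.card_compl, hs, Multiset.sum_replicate]; decide)
        (fun a ha => by rw [Multiset.eq_of_mem_replicate ha]; decide) (by decide)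
      have hk := elementKey_of_cycleType one_pos hz
      refine ⟨z, ?_, ?_⟩
      · rw [Set.mem_ofPred_eq, hk]
        exact (hmain _).2 (Or.inl rfl)
      · rw [hL3 z hk]
        refine Finset.eq_of_subset_of_card_le ?_ ?_
        · have h1 := Finset.subset_compl_iff_disjoint_left.2 hd
          rwa [compl_compl] at h1
        · rw [hs, card_support_of_elementKey Nat.prime_three hk, one_mul]
  rw [numComponents_properPowerGraph_alternating hI L, himg, Set.ncard_coe_finset,
    Finset.card_powersetCard]
  · norm_num [Nat.choose]
  · intro x y hx hy hxI hyI hne hxy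
    rcases hkey x hx hxI with h | h <;> rcases hkey y hy hyI with h' | h'
    · exact absurd (congrArg Prod.fst (h.trans h'.symm)) hne
    · rw [hL3 x h, hL2 y h', support_eq_compl_of_commute h h' hxy]
    · rw [hL3 y h', hL2 x h, support_eq_compl_of_commute h' h hxy.symm]
    · exact absurd (congrArg Prod.fst (h.trans h'.symm)) hne
  · intro x y hx hxI hxy
    have hk := elementKey_eq_of_zpowers_eq (prime_orderOf_of_elementKey_mem hx) hxy
    have hs : (x : Equiv.Perm (Fin 7)).support = (y : Equiv.Perm (Fin 7)).support :=
      Finset.Subset.antisymm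
        (support_subset_of_mem_zpowers (hxy ▸ Subgroup.mem_zpowers x))
        (support_subset_of_mem_zpowers (hxy ▸ Subgroup.mem_zpowers y))
    simp only [L, hk, hs]
  · have h3 : ∀ x, elementKey x = (3, 1) → ∃ z, elementKey z = (2, 2) ∧ PowReach x z ∧
        (z : Equiv.Perm (Fin 7)).support = (L x)ᶜ := by
      intro x h
      obtain ⟨z, hz, hkz, hs⟩ := exists_disjoint_of_key x 3 1 2 2 (by norm_num) Nat.prime_two
        two_pos (fun _ => even_two) (card_support_of_elementKey Nat.prime_three h)
      refine ⟨z, hkz, powReach_of_support_compl (congrArg Prod.fst h) hz ?_, ?_⟩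
      · rw [hs, compl_compl]
      · rw [hL3 x h, hs]
    have h2 : ∀ x y, elementKey x = (3, 1) → elementKey y = (2, 2) → L x = L y →
        PowReach x y := by
      intro x y hx hy h
      refine powReach_of_support_compl (congrArg Prod.fst hx) (congrArg Prod.fst hy) ?_
      rw [← hL3 x hx, h, hL2 y hy]
    have h2' : ∀ x, elementKey x = (2, 2) → ∃ z, elementKey z = (3, 1) ∧ L z = L x := by
      intro x h
      obtain ⟨z, hz, hkz, hs⟩ := exists_disjoint_of_key x 2 2 3 1 (by norm_num) Nat.prime_three
        one_pos (by norm_num) (card_support_of_elementKey Nat.prime_two h)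
      exact ⟨z, hkz, by rw [hL3 z hkz, hL2 x h, hs]⟩
    have h33 : ∀ x y, elementKey x = (3, 1) → elementKey y = (3, 1) → L x = L y →
        PowReach x y := by
      intro x y hx hy h
      obtain ⟨z, hkz, hxz, hs⟩ := h3 x hx
      refine hxz.trans (h2 y z hy hkz ?_).symm
      rw [hL2 z hkz, hs, compl_compl, h]
    intro x y hx hy hxI hyI h
    rcases hkey x hx hxI with h' | h' <;> rcases hkey y hy hyI with h'' | h''
    · exact h33 x y h' h'' h
    · exact h2 x y h' h'' h
    · exact (h2 y x h'' h' h.symm).symm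
    · obtain ⟨z, hkz, hz⟩ := h2' x h'
      exact (h2 z x hkz h' hz).symm.trans (h2 z y hkz h'' (hz.trans h))
  · exact Set.toFinite _

end SevenPoints

/-! ### Chains of links to (3, 1) and the isolated keys in degree at least 11 -/

section Chains

variable {n : ℕ}

theorem keyLink_two_three (hn : 7 ≤ n) : KeyLink n (3, 1) (2, 2) :=
  ⟨Nat.prime_three, Nat.prime_two, by simp, by simp, by simp, 1, 2, 0, by simp, by simp,
    by simpa using hn, by simp, by simp⟩

theorem keyLink_three_prime {p : ℕ} (hp : p.Prime) (h5 : 5 ≤ p) (hn : p + 3 ≤ n) :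
    KeyLink n (3, 1) (p, 1) :=
  ⟨Nat.prime_three, hp, by dsimp only; omega, by simp, by simp, 1, 1, 0, by simp, by simp,
    by dsimp only; omega, by simp, by dsimp only; omega⟩

theorem keyLink_two_sq_three_sq (hn : 10 ≤ n) : KeyLink n (2, 2) (3, 2) :=
  ⟨Nat.prime_two, Nat.prime_three, by simp, by simp, by simp, 2, 2, 0, by simp, by simp,
    by simpa using hn, by simp, by simp⟩

/-- One 6-cycle and k - 3 transpositions use 2k points: the 6-cycle yields two 3-cycles on squaring
and three transpositions on cubing. There are k - 2 odd cycles, an even number. -/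
theorem keyLink_three_sq_two_pow {k : ℕ} (hk : Even k) (h4 : 4 ≤ k) (hn : 2 * k ≤ n) :
    KeyLink n (3, 2) (2, k) :=
  ⟨Nat.prime_three, Nat.prime_two, by simp, by simp, by dsimp only; omega, 0, k - 3, 1, by simp,
    by dsimp only; omega, by dsimp only; omega, by simp, fun _ => by
      rw [Nat.even_iff] at hk ⊢
      omega⟩

theorem reach_two (hn : 10 ≤ n) {k : ℕ} (hk : Even k) (h0 : 0 < k) (hkn : 2 * k ≤ n) :
    ReflTransGen (KeyLink n) (3, 1) (2, k) := by
  have h2 : ReflTransGen (KeyLink n) (3, 1) (2, 2) :=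
    ReflTransGen.single (keyLink_two_three (by omega))
  by_cases hk2 : k = 2
  · rwa [hk2]
  · refine (h2.tail (keyLink_two_sq_three_sq hn)).tail (keyLink_three_sq_two_pow hk ?_ hkn)
    rw [Nat.even_iff] at hk
    omega

theorem reach_three_sq (hn : 10 ≤ n) : ReflTransGen (KeyLink n) (3, 1) (3, 2) :=
  (reach_two hn even_two two_pos (by omega)).tail (keyLink_two_sq_three_sq hn)

theorem reach_three (hn : 11 ≤ n) {k : ℕ} (h0 : 0 < k) (hkn : 3 * k ≤ n) :
    ReflTransGen (KeyLink n) (3, 1) (3, k) := by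
  by_cases h1 : k = 1
  · rw [h1]
  by_cases h2 : k = 2
  · rw [h2]
    exact reach_three_sq (by omega)
  by_cases h3 : 3 * k + 2 ≤ n
  -- A 6-cycle, a transposition (for parity) and k - 2 cycles of length 3, on 3k + 2 points in all.
  · refine (reach_two (by omega) (k := 4) (by decide) (by decide) (by omega)).tail ?_
    exact ⟨Nat.prime_two, Nat.prime_three, by simp, by simp, by simpa using h0, 1, k - 2, 1,
      by simp, by dsimp only; omega, by dsimp only; omega, fun _ => by decide, by simp⟩
  -- Here 3k + 2 > n ≥ 11 forces k ≥ 4, so two 6-cycles fit and parity holds without any extra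
  -- point.
  · refine (reach_two (by omega) (k := 6) (by decide) (by decide) (by omega)).tail ?_
    exact ⟨Nat.prime_two, Nat.prime_three, by simp, by simp, by simpa using h0, 0, k - 4, 2,
      by simp, by dsimp only; omega, by dsimp only; omega, fun _ => by decide, by simp⟩

/-- A 2p-cycle squares to two p-cycles. It is odd, and the transposition that corrects its sign
accounts for the two extra points. -/
theorem reach_prime_sq (hn : 11 ≤ n) {p : ℕ} (hp : p.Prime) (h5 : 5 ≤ p) (hpn : 2 * p + 2 ≤ n) :
    ReflTransGen (KeyLink n) (3, 1) (p, 2) := by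
  have hodd : Even (p + 1) := (hp.odd_of_ne_two (by omega)).add_one
  refine (reach_two (by omega) hodd (by omega) (by omega)).tail ?_
  exact ⟨Nat.prime_two, hp, by dsimp only; omega, by simp, by simp, 1, 0, 1, by dsimp only; omega,
    by simp, by dsimp only; omega, fun _ => by decide, by dsimp only; omega⟩

/-- Three of the p-cycles are merged into one 3p-cycle, which is even and needs no further points;
it links to the key (3, p). -/
theorem reach_prime_pow (hn : 11 ≤ n) {p k : ℕ} (hp : p.Prime) (h5 : 5 ≤ p) (h3 : 3 ≤ k)
    (hpn : p * k ≤ n) : ReflTransGen (KeyLink n) (3, 1) (p, k) := by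
  obtain ⟨j, rfl⟩ := Nat.exists_eq_add_of_le h3
  have h1 : p * (3 + j) = 3 * p + p * j := by ring
  refine (reach_three hn (k := p) (by omega) (by omega)).tail ?_
  exact ⟨Nat.prime_three, hp, by dsimp only; omega, by dsimp only; omega, by dsimp only; omega,
    0, j, 1, by simp, by dsimp only; omega, by dsimp only; omega, by simp, by dsimp only; omega⟩

/-- The keys of elements whose centralizer leaves no room for another prime, in large degree. -/
def Cramped (n : ℕ) (κ : ℕ × ℕ) : Prop :=
  κ.2 = 1 ∧ n ≤ κ.1 + 2 ∨ κ.2 = 2 ∧ n ≤ 2 * κ.1 + 1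

/-- For k = 1 no cycle of length pq fits the count, and at most 2 free points allow only one
transposition, which is odd. For k = 2 either no q-cycle fits beside the p-cycles, or both are
merged in one 2p-cycle, which is odd and has no room for a correcting transposition. -/
theorem Cramped.not_keyLink {κ κ' : ℕ × ℕ} (h3 : κ.1 ≠ 2) (h : Cramped n κ) :
    ¬ KeyLink n κ κ' := by
  obtain ⟨p, k⟩ := κ
  obtain ⟨q, l⟩ := κ'
  rintro ⟨hp, hq, hne, hk, hl, a, b, c, h1, h2, h3, h4, h5⟩
  dsimp only [Cramped] at *
  have hq2 := hq.two_le
  have hbq : b ≠ 0 → 2 ≤ q * b ∧ (q * b = 2 → q = 2 ∧ b = 1) := by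
    intro hb
    have : q * 1 ≤ q * b := Nat.mul_le_mul_left q (Nat.pos_of_ne_zero hb)
    have : 2 * b ≤ q * b := Nat.mul_le_mul_right b hq2
    omega
  rcases h with ⟨rfl, hn⟩ | ⟨rfl, hn⟩
  · have hc : c = 0 := by
      by_contra hc
      have : q * 1 ≤ q * c := Nat.mul_le_mul_left q (Nat.pos_of_ne_zero hc)
      omega
    subst hc
    have hb : b ≠ 0 := by omega
    obtain ⟨hb1, hb2⟩ := hbq hb
    obtain rfl : a = 1 := by omega
    obtain ⟨rfl, rfl⟩ := hb2 (by omega)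
    exact absurd (h5 rfl) (by decide)
  · rcases Nat.eq_zero_or_pos c with rfl | hc
    · have hb : b ≠ 0 := by omega
      obtain ⟨hb1, hb2⟩ := hbq hb
      obtain rfl : a = 2 := by omega
      omega
    · have h6 : q * 1 ≤ q * c := Nat.mul_le_mul_left q hc
      have h7 : 2 * c ≤ q * c := Nat.mul_le_mul_right c hq2
      obtain rfl : c = 1 := by omega
      obtain rfl : q = 2 := by omega
      have hb : b = 0 := by
        by_contra hb
        have := (hbq hb).1
        omega
      subst hb
      exact absurd (h5 rfl) (by decide)

theorem reach_of_not_cramped (hn : 11 ≤ n) {κ : ℕ × ℕ} (hκ : κ ∈ keys n) (h : ¬ Cramped n κ) :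
    ReflTransGen (KeyLink n) (3, 1) κ := by
  obtain ⟨p, k⟩ := κ
  obtain ⟨hp, hk, hs, he⟩ := hκ
  dsimp only [Cramped] at *
  by_cases h2 : p = 2
  · subst h2
    exact reach_two (by omega) (he rfl) hk hs
  by_cases h3 : p = 3
  · subst h3
    exact reach_three hn hk hs
  have h5 : 5 ≤ p := by
    have h4 : p ≠ 4 := by
      rintro rfl
      exact absurd hp (by norm_num)
    have := hp.two_le
    omega
  by_cases hk1 : k = 1
  · subst hk1
    exact ReflTransGen.single (keyLink_three_prime hp h5 (by omega))
  by_cases hk2 : k = 2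
  · subst hk2
    exact reach_prime_sq hn hp h5 (by omega)
  · exact reach_prime_pow hn hp h5 (by omega) hs

theorem keyClassification_of_eleven_le (hn : 11 ≤ n) {I : Finset (ℕ × ℕ)}
    (hI : ∀ κ, κ ∈ I ↔ κ ∈ keys n ∧ Cramped n κ) :
    KeyClassification n {(3, 1)} I fun _ => (3, 1) where
  isolated κ hκ := by
    obtain ⟨h1, h2⟩ := (hI κ).1 hκ
    refine ⟨h1, fun κ' => h2.not_keyLink ?_⟩
    rintro h3
    simp only [Cramped, h3] at h2
    omega
  main m hm := by
    obtain rfl := Finset.mem_singleton.1 hm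
    refine ⟨(keyLink_two_three (by omega)).mem_left, fun h => ?_, rfl⟩
    have := ((hI _).1 h).2
    simp only [Cramped] at this
    omega
  link _ _ _ := rfl
  reach κ hκ hκI := ⟨Finset.mem_singleton_self _, reach_of_not_cramped hn hκ fun h =>
    hκI ((hI κ).2 ⟨hκ, h⟩)⟩

theorem altCounts_of_eleven_le (hn : 11 ≤ n) {I : Finset (ℕ × ℕ)} {J : Finset ℕ}
    (hI : ∀ κ, κ ∈ I ↔ κ ∈ keys n ∧ Cramped n κ)
    (hJ : ∀ p, p ∈ J ↔ p.Prime ∧ p ≤ n ∧ n ≤ p + 2) {c : ℚ} {t o : ℕ}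
    (hc : ∑ κ ∈ I, subgroupCount n κ + 1 = c) (ht : I.card + 1 = t) (ho : J.card + 1 = o) :
    AltCounts n c t o := by
  have hcl := keyClassification_of_eleven_le hn hI
  have hP := hcl.numComponents_power (by
    intro m hm
    obtain rfl := Finset.mem_singleton.1 hm
    exact mainKey_three (by omega))
  rw [Finset.card_singleton, Nat.cast_one, add_comm, hc] at hP
  refine hcl.altCounts (J := J) hP (by rwa [Finset.card_singleton, add_comm]) ?_ ?_ ?_ ?_
    (by rwa [Finset.image_singleton, Finset.card_singleton, add_comm])
  · intro m hm
    rw [Finset.mem_singleton.1 hm]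
  · intro p hp
    obtain ⟨h1, h2, h3⟩ := (hJ p).1 hp
    exact ⟨1, h1, one_pos, by simpa using h2, by dsimp only; omega⟩
  · rintro ⟨p, k⟩ hκ hp
    obtain ⟨h1, h2, h3⟩ := (hJ p).1 hp
    refine (hI _).2 ⟨hκ, Or.inl ⟨?_, h3⟩⟩
    obtain ⟨-, hk, hs, -⟩ := hκ
    dsimp only at hk hs ⊢
    by_contra hk1
    have : p * 2 ≤ p * k := Nat.mul_le_mul_left p (by omega)
    omega
  · rintro ⟨p, k⟩ hκ
    obtain ⟨⟨hp, hk, hs, -⟩, h⟩ := (hI _).1 hκ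
    dsimp only [Cramped] at *
    rcases h with ⟨rfl, h⟩ | ⟨rfl, h⟩
    · exact Or.inl ((hJ p).2 ⟨hp, by omega, h⟩)
    -- An isolated key (p, 2) does not isolate the prime p: since p is about n/2, the key (p, 1)
    -- still has room.
    · refine Or.inr ⟨1, ⟨hp, one_pos, by dsimp only; omega, by dsimp only; omega⟩, fun h1 => ?_⟩
      have := ((hI _).1 h1).2
      simp only at this
      omega

end Chains

/-! ### Closed formulas and the case table for degree at least 11 -/

section LargeDegree

theorem subgroupCount_self {n : ℕ} (hn : 4 ≤ n) :
    subgroupCount n (n, 1) = ((n - 2).factorial : ℚ) := by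
  obtain ⟨m, rfl⟩ := Nat.exists_eq_add_of_le' hn
  have h2 : m + 4 - 2 = m + 2 := by omega
  have h1 : (m : ℚ) + 4 ≠ 0 := by positivity
  have h3 : (m : ℚ) + 4 - 1 ≠ 0 := by ring_nf; positivity
  simp only [subgroupCount, h2, mul_one, Nat.sub_self, Nat.factorial]
  push_cast
  field_simp
  ring

theorem subgroupCount_pred {n : ℕ} (hn : 4 ≤ n) :
    subgroupCount n (n - 1, 1) = n * ((n - 3).factorial : ℚ) := by
  obtain ⟨m, rfl⟩ := Nat.exists_eq_add_of_le' hn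
  have h1 : m + 4 - 1 = m + 3 := by omega
  have h2 : m + 4 - 3 = m + 1 := by omega
  have h3 : m + 4 - (m + 3) = 1 := by omega
  have h4 : (m : ℚ) + 3 ≠ 0 := by positivity
  have h5 : (m : ℚ) + 3 - 1 ≠ 0 := by ring_nf; positivity
  simp only [subgroupCount, h1, h2, mul_one, h3, Nat.factorial]
  push_cast
  field_simp
  ring

theorem subgroupCount_sub_two {n : ℕ} (hn : 4 ≤ n) :
    subgroupCount n (n - 2, 1) = (n : ℚ) * (n - 1) * ((n - 4).factorial : ℚ) / 2 := by
  obtain ⟨m, rfl⟩ := Nat.exists_eq_add_of_le' hn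
  have h1 : m + 4 - 2 = m + 2 := by omega
  have h2 : m + 4 - 4 = m := by omega
  have h3 : m + 4 - (m + 2) = 2 := by omega
  have h4 : (m : ℚ) + 2 ≠ 0 := by positivity
  have h5 : (m : ℚ) + 2 - 1 ≠ 0 := by ring_nf; positivity
  simp only [subgroupCount, h1, h2, mul_one, h3, Nat.factorial]
  push_cast
  field_simp
  ring

theorem subgroupCount_half_of_even {n : ℕ} (hn : 4 ≤ n) (he : Even n) :
    subgroupCount n (n / 2, 2) = 4 * (n - 1) * ((n - 3).factorial : ℚ) / n := by
  obtain ⟨q, rfl⟩ := he.two_dvd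
  obtain ⟨m, rfl⟩ := Nat.exists_eq_add_of_le' (show 2 ≤ q by omega)
  have h1 : 2 * (m + 2) / 2 = m + 2 := by omega
  have h2 : 2 * (m + 2) - 3 = 2 * m + 1 := by omega
  have h3 : 2 * (m + 2) - (m + 2) * 2 = 0 := by omega
  have h4 : (m : ℚ) + 2 ≠ 0 := by positivity
  have h5 : (m : ℚ) + 2 - 1 ≠ 0 := by ring_nf; positivity
  have h6 : (2 * (m + 2)).factorial = (2 * m + 4).factorial := rfl
  simp only [subgroupCount, h1, h2, h3, h6]
  simp only [Nat.factorial]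
  push_cast
  field_simp
  ring

theorem subgroupCount_half_of_odd {n : ℕ} (hn : 5 ≤ n) (he : Odd n) :
    subgroupCount n (n / 2, 2) =
      4 * n * (n - 2) * ((n - 4).factorial : ℚ) / (n - 1) := by
  obtain ⟨q, rfl⟩ := he
  obtain ⟨m, rfl⟩ := Nat.exists_eq_add_of_le' (show 2 ≤ q by omega)
  have h1 : (2 * (m + 2) + 1) / 2 = m + 2 := by omega
  have h2 : 2 * (m + 2) + 1 - 4 = 2 * m + 1 := by omega
  have h3 : 2 * (m + 2) + 1 - (m + 2) * 2 = 1 := by omega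
  have h4 : (m : ℚ) + 2 ≠ 0 := by positivity
  have h5 : (m : ℚ) + 2 - 1 ≠ 0 := by ring_nf; positivity
  have h6 : (2 * (m + 2) + 1).factorial = (2 * m + 5).factorial := rfl
  have h7 : 2 * ((m : ℚ) + 2) + 1 - 1 ≠ 0 := by ring_nf; positivity
  simp only [subgroupCount, h1, h2, h3, h6]
  simp only [Nat.factorial]
  push_cast
  field_simp
  ring

/-- The component counts in degree at least 11, as sums of contributions of the four types which
may be isolated. -/
theorem altCounts_large {n : ℕ} (hn : 11 ≤ n) {c : ℚ} {t o : ℕ}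
    (hc : (if n.Prime then ((n - 2).factorial : ℚ) else 0) +
      ((if (n - 1).Prime then n * ((n - 3).factorial : ℚ) else 0) +
      ((if (n - 2).Prime then (n : ℚ) * (n - 1) * ((n - 4).factorial : ℚ) / 2 else 0) +
      if (n / 2).Prime then subgroupCount n (n / 2, 2) else 0)) + 1 = c)
    (ht : (if n.Prime then 1 else 0) + ((if (n - 1).Prime then 1 else 0) +
      ((if (n - 2).Prime then 1 else 0) + if (n / 2).Prime then 1 else 0)) + 1 = t)
    (ho : (if n.Prime then 1 else 0) + ((if (n - 1).Prime then 1 else 0) +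
      if (n - 2).Prime then 1 else 0) + 1 = o) : AltCounts n c t o := by
  have h1 : (n, 1) ∉ ({(n - 1, 1), (n - 2, 1), (n / 2, 2)} : Finset (ℕ × ℕ)) := by
    simp only [Finset.mem_insert, Finset.mem_singleton, Prod.mk.injEq]
    omega
  have h2 : (n - 1, 1) ∉ ({(n - 2, 1), (n / 2, 2)} : Finset (ℕ × ℕ)) := by
    simp only [Finset.mem_insert, Finset.mem_singleton, Prod.mk.injEq]
    omega
  have h3 : (n - 2, 1) ∉ ({(n / 2, 2)} : Finset (ℕ × ℕ)) := by simp
  have h4 : n ∉ ({n - 1, n - 2} : Finset ℕ) := by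
    simp only [Finset.mem_insert, Finset.mem_singleton]
    omega
  have h5 : n - 1 ∉ ({n - 2} : Finset ℕ) := by
    simp only [Finset.mem_singleton]
    omega
  refine altCounts_of_eleven_le hn
    (I := ({(n, 1), (n - 1, 1), (n - 2, 1), (n / 2, 2)} : Finset (ℕ × ℕ)).filter
      fun κ => κ.1.Prime)
    (J := ({n, n - 1, n - 2} : Finset ℕ).filter Nat.Prime) ?_ ?_ ?_ ?_ ?_
  · rintro ⟨p, k⟩
    simp only [Finset.mem_filter, Finset.mem_insert, Finset.mem_singleton, Prod.mk.injEq, keys,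
      Cramped, Set.mem_ofPred_eq]
    constructor
    · rintro ⟨(⟨rfl, rfl⟩ | ⟨rfl, rfl⟩ | ⟨rfl, rfl⟩ | ⟨rfl, rfl⟩), hp⟩
      · exact ⟨⟨hp, by omega, by omega, by omega⟩, by omega⟩
      · exact ⟨⟨hp, by omega, by omega, by omega⟩, by omega⟩
      · exact ⟨⟨hp, by omega, by omega, by omega⟩, by omega⟩
      · exact ⟨⟨hp, by omega, by omega, by omega⟩, by omega⟩
    · rintro ⟨⟨hp, hk, hs, -⟩, (⟨rfl, h⟩ | ⟨rfl, h⟩)⟩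
      · exact ⟨by omega, hp⟩
      · exact ⟨by omega, hp⟩
  · intro p
    simp only [Finset.mem_filter, Finset.mem_insert, Finset.mem_singleton]
    constructor
    · rintro ⟨h, hp⟩
      exact ⟨hp, by omega⟩
    · rintro ⟨hp, h⟩
      exact ⟨by omega, hp⟩
  · rw [← hc, Finset.sum_filter, Finset.sum_insert h1, Finset.sum_insert h2,
      Finset.sum_insert h3, Finset.sum_singleton, subgroupCount_self (by omega),
      subgroupCount_pred (by omega), subgroupCount_sub_two (by omega)]
  · rw [← ht, Finset.card_filter, Finset.sum_insert h1, Finset.sum_insert h2,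
      Finset.sum_insert h3, Finset.sum_singleton]
  · rw [← ho, Finset.card_filter, Finset.sum_insert h4, Finset.sum_insert h5,
      Finset.sum_singleton]

theorem mem_primesAffine_one {n c : ℕ} (hc : c ≤ n) :
    n ∈ primesAffine 1 c ↔ (n - c).Prime := by
  constructor
  · rintro ⟨p, hp, rfl⟩
    simpa using hp
  · exact fun h => ⟨n - c, h, by omega⟩

theorem mem_primesAffine_two_zero {n : ℕ} :
    n ∈ primesAffine 2 0 ↔ Even n ∧ (n / 2).Prime := by
  constructor
  · rintro ⟨p, hp, rfl⟩
    simpa using hp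
  · rintro ⟨h1, h2⟩
    exact ⟨n / 2, h2, by rw [Nat.even_iff] at h1; omega⟩

theorem mem_primesAffine_two_one {n : ℕ} :
    n ∈ primesAffine 2 1 ↔ ¬ Even n ∧ (n / 2).Prime := by
  constructor
  · rintro ⟨p, hp, rfl⟩
    have h : (2 * p + 1) / 2 = p := by omega
    refine ⟨?_, by rwa [h]⟩
    rw [Nat.even_iff]
    omega
  · rintro ⟨h1, h2⟩
    exact ⟨n / 2, h2, by rw [Nat.even_iff] at h1; omega⟩

theorem not_even_of_prime_sub {n c : ℕ} (h : (n - c).Prime) (h2 : c + 2 < n) (hc : Even c) :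
    ¬ Even n := by
  have := h.odd_of_ne_two (by omega)
  rw [Nat.even_iff] at hc ⊢
  rw [Nat.odd_iff] at this
  omega

theorem even_of_prime_pred {n : ℕ} (h : (n - 1).Prime) (h2 : 3 < n) : Even n := by
  have := h.odd_of_ne_two (by omega)
  rw [Nat.even_iff]
  rw [Nat.odd_iff] at this
  omega

/-- Modulo 3: if 3 divides neither n nor n - 2, then n ≡ 1, so 3 divides (n - 1)/2. This is why the
table has no row with all three primes, and why its first three rows need no further exclusions. -/
theorem not_three_primes {n : ℕ} (hn : 11 ≤ n) (h0 : n.Prime) (h2 : (n - 2).Prime)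
    (he : ¬ Even n) (hh : (n / 2).Prime) : False := by
  have key : ∀ p : ℕ, p.Prime → 5 ≤ p → p % 3 ≠ 0 := by
    intro p hp h5 h
    have := (Nat.prime_dvd_prime_iff_eq Nat.prime_three hp).1 (Nat.dvd_of_mod_eq_zero h)
    omega
  have h3 := key n h0 (by omega)
  have h4 := key _ h2 (by omega)
  have h5 := key _ hh (by omega)
  rw [Nat.even_iff] at he
  have h6 : n / 2 % 3 = 1 ∨ n / 2 % 3 = 2 := by omega
  rcases h6 with h6 | h6 <;> omega

theorem altCounts_of_critical {n : ℕ} (hn : 11 ≤ n) :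
      (n ∈ primesAffine 1 2 → n ∈ primesAffine 2 1 →
        AltCounts n ((n : ℚ) * (n - 1) * ((n - 4).factorial : ℚ) / 2
          + 4 * n * (n - 2) * ((n - 4).factorial : ℚ) / (n - 1) + 1) 3 2) ∧
      (n.Prime → n ∈ primesAffine 2 1 →
        AltCounts n (((n - 2).factorial : ℚ)
          + 4 * n * (n - 2) * ((n - 4).factorial : ℚ) / (n - 1) + 1) 3 2) ∧
      (n.Prime → n ∈ primesAffine 1 2 →
        AltCounts n (((n - 2).factorial : ℚ)
          + (n : ℚ) * (n - 1) * ((n - 4).factorial : ℚ) / 2 + 1) 3 3) ∧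
      (n ∈ primesAffine 1 2 → ¬ n.Prime → n ∉ primesAffine 2 1 →
        AltCounts n ((n : ℚ) * (n - 1) * ((n - 4).factorial : ℚ) / 2 + 1) 2 2) ∧
      (n ∈ primesAffine 2 1 → ¬ n.Prime → n ∉ primesAffine 1 2 →
        AltCounts n (4 * n * (n - 2) * ((n - 4).factorial : ℚ) / (n - 1) + 1) 2 1) ∧
      (n.Prime → n ∉ primesAffine 1 2 → n ∉ primesAffine 2 1 →
        AltCounts n (((n - 2).factorial : ℚ) + 1) 2 2) ∧
      (n ∈ primesAffine 1 1 → n ∉ primesAffine 2 0 →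
        AltCounts n (n * ((n - 3).factorial : ℚ) + 1) 2 2) ∧
      (n ∈ primesAffine 1 1 → n ∈ primesAffine 2 0 →
        AltCounts n (4 * (n - 1) * ((n - 3).factorial : ℚ) / n
          + n * ((n - 3).factorial : ℚ) + 1) 3 2) ∧
      (n ∈ primesAffine 2 0 → n ∉ primesAffine 1 1 →
        AltCounts n (4 * (n - 1) * ((n - 3).factorial : ℚ) / n + 1) 2 1) ∧
      (n ∉ criticalDegrees → AltCounts n 1 1 1) := by
  have e0 : n ∈ primesAffine 1 0 ↔ n.Prime := mem_primesAffine_one (Nat.zero_le n)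
  have e1 : n ∈ primesAffine 1 1 ↔ (n - 1).Prime := mem_primesAffine_one (by omega)
  have e2 : n ∈ primesAffine 1 2 ↔ (n - 2).Prime := mem_primesAffine_one (by omega)
  have p0 : n.Prime → ¬ Even n := fun h =>
    not_even_of_prime_sub (c := 0) h (by omega) (by decide)
  have p1 : (n - 1).Prime → Even n := fun h => even_of_prime_pred h (by omega)
  have p2 : (n - 2).Prime → ¬ Even n := fun h => not_even_of_prime_sub h (by omega) even_two
  have p3 := fun h0 h2 he hh => not_three_primes hn h0 h2 he hh
  have v0 : Even n → _ := subgroupCount_half_of_even (n := n) (by omega)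
  have v1 : ¬ Even n → _ := fun h =>
    subgroupCount_half_of_odd (n := n) (by omega) (Nat.not_even_iff_odd.1 h)
  have L := fun c t o => altCounts_large hn (c := c) (t := t) (o := o)
  simp only [criticalDegrees, Set.mem_union, e0, e1, e2, mem_primesAffine_two_zero,
    mem_primesAffine_two_one]
  -- In this range primality of n or n - 2 forces n odd, that of n - 1 forces n even; and n / 2 is
  -- n/2 or (n - 1)/2 according to parity.
  by_cases he : Even n
  · have q0 : ¬ n.Prime := fun h => p0 h he
    have q2 : ¬ (n - 2).Prime := fun h => p2 h he
    rw [v0 he] at L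
    by_cases q1 : (n - 1).Prime <;> by_cases qh : (n / 2).Prime <;>
      simp only [he, q0, q1, q2, qh, if_true, if_false, not_true, not_false_iff, and_false,
        false_imp_iff, true_imp_iff, and_true, true_and, or_false, or_true] at L ⊢
    · exact L _ _ _ (by ring) rfl rfl
    · exact L _ _ _ (by ring) rfl rfl
    · exact L _ _ _ (by ring) rfl rfl
    · exact L _ _ _ (by ring) rfl rfl
  · have q1 : ¬ (n - 1).Prime := fun h => he (p1 h)
    rw [v1 he] at L
    by_cases q0 : n.Prime <;> by_cases q2 : (n - 2).Prime <;> by_cases qh : (n / 2).Prime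
    · exact (p3 q0 q2 he qh).elim
    all_goals
      simp only [he, q0, q1, q2, qh, if_true, if_false, not_true, not_false_iff, and_false,
        false_imp_iff, true_imp_iff, and_true, true_and, or_false, or_true] at L ⊢
      exact L _ _ _ (by ring) rfl rfl

end LargeDegree

/-! ### Degrees 3 to 10 -/

section SmallDegree

theorem le_of_mem_keys {n : ℕ} {κ : ℕ × ℕ} (h : κ ∈ keys n) : κ.1 ≤ n ∧ κ.2 ≤ n := by
  obtain ⟨hp, hk, hs, -⟩ := h
  exact ⟨(Nat.le_mul_of_pos_right _ hk).trans hs, (Nat.le_mul_of_pos_left _ hp.pos).trans hs⟩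

theorem mem_keys_three (κ : ℕ × ℕ) :
    κ ∈ ({(3, 1)} : Finset (ℕ × ℕ)) ↔ κ ∈ keys 3 := by
  obtain ⟨p, k⟩ := κ
  simp only [Finset.mem_singleton, Prod.mk.injEq]
  constructor
  · rintro ⟨rfl, rfl⟩
    norm_num [keys, Nat.even_iff]
  · intro h
    have hp := (le_of_mem_keys h).1
    obtain ⟨h1, h2, h3, h4⟩ := h
    dsimp only at *
    rw [Nat.even_iff] at h4
    interval_cases p <;> first | omega | exact absurd h1 (by norm_num)

theorem mem_keys_four (κ : ℕ × ℕ) :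
    κ ∈ ({(2, 2), (3, 1)} : Finset (ℕ × ℕ)) ↔ κ ∈ keys 4 := by
  obtain ⟨p, k⟩ := κ
  simp only [Finset.mem_insert, Finset.mem_singleton, Prod.mk.injEq]
  constructor
  · rintro (⟨rfl, rfl⟩ | ⟨rfl, rfl⟩) <;> norm_num [keys, Nat.even_iff]
  · intro h
    have hp := (le_of_mem_keys h).1
    obtain ⟨h1, h2, h3, h4⟩ := h
    dsimp only at *
    rw [Nat.even_iff] at h4
    interval_cases p <;> first | omega | exact absurd h1 (by norm_num)

theorem mem_keys_five (κ : ℕ × ℕ) :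
    κ ∈ ({(2, 2), (3, 1), (5, 1)} : Finset (ℕ × ℕ)) ↔ κ ∈ keys 5 := by
  obtain ⟨p, k⟩ := κ
  simp only [Finset.mem_insert, Finset.mem_singleton, Prod.mk.injEq]
  constructor
  · rintro (⟨rfl, rfl⟩ | ⟨rfl, rfl⟩ | ⟨rfl, rfl⟩) <;> norm_num [keys, Nat.even_iff]
  · intro h
    have hp := (le_of_mem_keys h).1
    obtain ⟨h1, h2, h3, h4⟩ := h
    dsimp only at *
    rw [Nat.even_iff] at h4
    interval_cases p <;> first | omega | exact absurd h1 (by norm_num)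

theorem mem_keys_six (κ : ℕ × ℕ) :
    κ ∈ ({(2, 2), (3, 1), (3, 2), (5, 1)} : Finset (ℕ × ℕ)) ↔ κ ∈ keys 6 := by
  obtain ⟨p, k⟩ := κ
  simp only [Finset.mem_insert, Finset.mem_singleton, Prod.mk.injEq]
  constructor
  · rintro (⟨rfl, rfl⟩ | ⟨rfl, rfl⟩ | ⟨rfl, rfl⟩ | ⟨rfl, rfl⟩) <;> norm_num [keys, Nat.even_iff]
  · intro h
    have hp := (le_of_mem_keys h).1
    obtain ⟨h1, h2, h3, h4⟩ := h
    dsimp only at *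
    rw [Nat.even_iff] at h4
    interval_cases p <;> first | omega | exact absurd h1 (by norm_num)

theorem mem_keys_seven (κ : ℕ × ℕ) :
    κ ∈ ({(2, 2), (3, 1), (3, 2), (5, 1), (7, 1)} : Finset (ℕ × ℕ)) ↔ κ ∈ keys 7 := by
  obtain ⟨p, k⟩ := κ
  simp only [Finset.mem_insert, Finset.mem_singleton, Prod.mk.injEq]
  constructor
  · rintro (⟨rfl, rfl⟩ | ⟨rfl, rfl⟩ | ⟨rfl, rfl⟩ | ⟨rfl, rfl⟩ | ⟨rfl, rfl⟩) <;> norm_num [keys, Nat.even_iff]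
  · intro h
    have hp := (le_of_mem_keys h).1
    obtain ⟨h1, h2, h3, h4⟩ := h
    dsimp only at *
    rw [Nat.even_iff] at h4
    interval_cases p <;> first | omega | exact absurd h1 (by norm_num)

theorem mem_keys_eight (κ : ℕ × ℕ) :
    κ ∈ ({(2, 2), (2, 4), (3, 1), (3, 2), (5, 1), (7, 1)} : Finset (ℕ × ℕ)) ↔ κ ∈ keys 8 := by
  obtain ⟨p, k⟩ := κ
  simp only [Finset.mem_insert, Finset.mem_singleton, Prod.mk.injEq]
  constructor
  · rintro (⟨rfl, rfl⟩ | ⟨rfl, rfl⟩ | ⟨rfl, rfl⟩ | ⟨rfl, rfl⟩ | ⟨rfl, rfl⟩ | ⟨rfl, rfl⟩) <;> norm_num [keys, Nat.even_iff]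
  · intro h
    have hp := (le_of_mem_keys h).1
    obtain ⟨h1, h2, h3, h4⟩ := h
    dsimp only at *
    rw [Nat.even_iff] at h4
    interval_cases p <;> first | omega | exact absurd h1 (by norm_num)

theorem mem_keys_nine (κ : ℕ × ℕ) :
    κ ∈ ({(2, 2), (2, 4), (3, 1), (3, 2), (3, 3), (5, 1), (7, 1)} : Finset (ℕ × ℕ)) ↔ κ ∈ keys 9 := by
  obtain ⟨p, k⟩ := κ
  simp only [Finset.mem_insert, Finset.mem_singleton, Prod.mk.injEq]
  constructor
  · rintro (⟨rfl, rfl⟩ | ⟨rfl, rfl⟩ | ⟨rfl, rfl⟩ | ⟨rfl, rfl⟩ | ⟨rfl, rfl⟩ | ⟨rfl, rfl⟩ | ⟨rfl, rfl⟩) <;> norm_num [keys, Nat.even_iff]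
  · intro h
    have hp := (le_of_mem_keys h).1
    obtain ⟨h1, h2, h3, h4⟩ := h
    dsimp only at *
    rw [Nat.even_iff] at h4
    interval_cases p <;> first | omega | exact absurd h1 (by norm_num)

theorem mem_keys_ten (κ : ℕ × ℕ) :
    κ ∈ ({(2, 2), (2, 4), (3, 1), (3, 2), (3, 3), (5, 1), (5, 2), (7, 1)} : Finset (ℕ × ℕ)) ↔ κ ∈ keys 10 := by
  obtain ⟨p, k⟩ := κ
  simp only [Finset.mem_insert, Finset.mem_singleton, Prod.mk.injEq]
  constructor
  · rintro (⟨rfl, rfl⟩ | ⟨rfl, rfl⟩ | ⟨rfl, rfl⟩ | ⟨rfl, rfl⟩ | ⟨rfl, rfl⟩ | ⟨rfl, rfl⟩ | ⟨rfl, rfl⟩ | ⟨rfl, rfl⟩) <;> norm_num [keys, Nat.even_iff]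
  · intro h
    have hp := (le_of_mem_keys h).1
    obtain ⟨h1, h2, h3, h4⟩ := h
    dsimp only at *
    rw [Nat.even_iff] at h4
    interval_cases p <;> first | omega | exact absurd h1 (by norm_num)

theorem not_keyLink_three : ∀ κ ∈ ({(3, 1)} : Finset (ℕ × ℕ)), ∀ κ',
    ¬ KeyLink 3 κ κ' := by
  rintro κ hκ ⟨q, l⟩ h
  have hq := (le_of_mem_keys h.mem_right).1
  obtain ⟨-, h2, h3, h4, h5, a, b, c, h6, h7, h8, h9, h10⟩ := h
  rw [Nat.even_iff] at h9 h10
  simp only [Finset.mem_singleton] at hκ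
  subst hκ
  dsimp only at *
  interval_cases q <;>
    first | omega | exact absurd h2 (by norm_num)

theorem not_keyLink_four : ∀ κ ∈ ({(2, 2), (3, 1)} : Finset (ℕ × ℕ)), ∀ κ',
    ¬ KeyLink 4 κ κ' := by
  rintro κ hκ ⟨q, l⟩ h
  have hq := (le_of_mem_keys h.mem_right).1
  obtain ⟨-, h2, h3, h4, h5, a, b, c, h6, h7, h8, h9, h10⟩ := h
  rw [Nat.even_iff] at h9 h10
  simp only [Finset.mem_insert, Finset.mem_singleton] at hκ
  rcases hκ with rfl | rfl <;> dsimp only at * <;> interval_cases q <;>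
    first | omega | exact absurd h2 (by norm_num)

theorem not_keyLink_five : ∀ κ ∈ ({(2, 2), (3, 1), (5, 1)} : Finset (ℕ × ℕ)), ∀ κ',
    ¬ KeyLink 5 κ κ' := by
  rintro κ hκ ⟨q, l⟩ h
  have hq := (le_of_mem_keys h.mem_right).1
  obtain ⟨-, h2, h3, h4, h5, a, b, c, h6, h7, h8, h9, h10⟩ := h
  rw [Nat.even_iff] at h9 h10
  simp only [Finset.mem_insert, Finset.mem_singleton] at hκ
  rcases hκ with rfl | rfl | rfl <;> dsimp only at * <;> interval_cases q <;>
    first | omega | exact absurd h2 (by norm_num)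

theorem not_keyLink_six : ∀ κ ∈ ({(2, 2), (3, 1), (3, 2), (5, 1)} : Finset (ℕ × ℕ)), ∀ κ',
    ¬ KeyLink 6 κ κ' := by
  rintro κ hκ ⟨q, l⟩ h
  have hq := (le_of_mem_keys h.mem_right).1
  obtain ⟨-, h2, h3, h4, h5, a, b, c, h6, h7, h8, h9, h10⟩ := h
  rw [Nat.even_iff] at h9 h10
  simp only [Finset.mem_insert, Finset.mem_singleton] at hκ
  rcases hκ with rfl | rfl | rfl | rfl <;> dsimp only at * <;> interval_cases q <;>
    first | omega | exact absurd h2 (by norm_num)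

theorem not_keyLink_seven : ∀ κ ∈ ({(3, 2), (5, 1), (7, 1)} : Finset (ℕ × ℕ)), ∀ κ',
    ¬ KeyLink 7 κ κ' := by
  rintro κ hκ ⟨q, l⟩ h
  have hq := (le_of_mem_keys h.mem_right).1
  obtain ⟨-, h2, h3, h4, h5, a, b, c, h6, h7, h8, h9, h10⟩ := h
  rw [Nat.even_iff] at h9 h10
  simp only [Finset.mem_insert, Finset.mem_singleton] at hκ
  rcases hκ with rfl | rfl | rfl <;> dsimp only at * <;> interval_cases q <;>
    first | omega | exact absurd h2 (by norm_num)

theorem not_keyLink_eight : ∀ κ ∈ ({(7, 1)} : Finset (ℕ × ℕ)), ∀ κ',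
    ¬ KeyLink 8 κ κ' := by
  rintro κ hκ ⟨q, l⟩ h
  have hq := (le_of_mem_keys h.mem_right).1
  obtain ⟨-, h2, h3, h4, h5, a, b, c, h6, h7, h8, h9, h10⟩ := h
  rw [Nat.even_iff] at h9 h10
  simp only [Finset.mem_singleton] at hκ
  subst hκ
  dsimp only at *
  interval_cases q <;>
    first | omega | exact absurd h2 (by norm_num)

theorem not_keyLink_nine : ∀ κ ∈ ({(3, 3), (7, 1)} : Finset (ℕ × ℕ)), ∀ κ',
    ¬ KeyLink 9 κ κ' := by
  rintro κ hκ ⟨q, l⟩ h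
  have hq := (le_of_mem_keys h.mem_right).1
  obtain ⟨-, h2, h3, h4, h5, a, b, c, h6, h7, h8, h9, h10⟩ := h
  rw [Nat.even_iff] at h9 h10
  simp only [Finset.mem_insert, Finset.mem_singleton] at hκ
  rcases hκ with rfl | rfl <;> dsimp only at * <;> interval_cases q <;>
    first | omega | exact absurd h2 (by norm_num)

/-- The key (3, 3) could meet the prime 2 only through a 6-cycle and a 3-cycle, and the
parity-correcting transposition would bring the total to 11 points. -/
theorem not_keyLink_ten : ∀ κ ∈ ({(3, 3), (5, 2)} : Finset (ℕ × ℕ)), ∀ κ',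
    ¬ KeyLink 10 κ κ' := by
  rintro κ hκ ⟨q, l⟩ h
  have hq := (le_of_mem_keys h.mem_right).1
  obtain ⟨-, h2, h3, h4, h5, a, b, c, h6, h7, h8, h9, h10⟩ := h
  rw [Nat.even_iff] at h9 h10
  simp only [Finset.mem_insert, Finset.mem_singleton] at hκ
  rcases hκ with rfl | rfl <;> dsimp only at * <;> interval_cases q <;>
    first | omega | exact absurd h2 (by norm_num)

theorem altCounts_three : AltCounts 3 1 1 1 :=
  altCounts_of_isolated mem_keys_three not_keyLink_three
    (by norm_num [subgroupCount, Nat.factorial]) rfl (by decide)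

theorem altCounts_four : AltCounts 4 7 2 2 :=
  altCounts_of_isolated mem_keys_four not_keyLink_four
    (by norm_num [subgroupCount, Nat.factorial]) rfl (by decide)

theorem altCounts_five : AltCounts 5 31 3 3 :=
  altCounts_of_isolated mem_keys_five not_keyLink_five
    (by norm_num [subgroupCount, Nat.factorial]) rfl (by decide)

theorem altCounts_six : AltCounts 6 121 4 3 :=
  altCounts_of_isolated mem_keys_six not_keyLink_six
    (by norm_num [subgroupCount, Nat.factorial]) rfl (by decide)

theorem keyClassification_seven :
    KeyClassification 7 {(3, 1)} {(3, 2), (5, 1), (7, 1)} fun _ => (3, 1) where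
  isolated κ hκ := ⟨(mem_keys_seven κ).1 (by
    revert κ
    decide), not_keyLink_seven κ hκ⟩
  main m hm := by
    obtain rfl := Finset.mem_singleton.1 hm
    exact ⟨(mem_keys_seven _).1 (by decide), by decide, rfl⟩
  link _ _ _ := rfl
  reach κ hκ hκI := by
    refine ⟨Finset.mem_singleton_self _, ?_⟩
    have h := (mem_keys_seven κ).2 hκ
    simp only [Finset.mem_insert, Finset.mem_singleton] at h hκI
    rcases h with rfl | rfl | rfl | rfl | rfl
    · exact ReflTransGen.single (keyLink_two_three le_rfl)
    · exact ReflTransGen.refl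
    all_goals simp at hκI

theorem altCounts_seven : AltCounts 7 421 4 3 := by
  -- The prime 3 is not in `J`, although (3, 2) is isolated, because (3, 1) is linked.
  refine keyClassification_seven.altCounts (J := {5, 7}) ?_ (by decide) (by decide) ?_ ?_ ?_
    (by decide)
  · rw [numComponents_properPowerGraph_seven keyClassification_seven.isolated]
    · norm_num [subgroupCount, Nat.factorial]
    · intro κ
      rw [← mem_keys_seven]
      simp only [Finset.mem_insert, Finset.mem_singleton]
      constructor
      · tauto
      · rintro (rfl | rfl) <;> simp
  · intro p hp
    refine ⟨1, (mem_keys_seven _).1 ?_⟩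
    simp only [Finset.mem_insert, Finset.mem_singleton] at hp
    rcases hp with rfl | rfl <;> decide
  · intro κ hκ
    rw [← mem_keys_seven] at hκ
    revert κ
    decide
  · intro κ hκ
    simp only [Finset.mem_insert, Finset.mem_singleton] at hκ
    rcases hκ with rfl | rfl | rfl
    · exact Or.inr ⟨1, (mem_keys_seven _).1 (by decide), by decide⟩
    · exact Or.inl (by decide)
    · exact Or.inl (by decide)

/-- The two classes of linked keys in degrees 8 and 9, with representatives `(3, 1)`, `(3, 2)`. -/
def twoClasses (κ : ℕ × ℕ) : ℕ × ℕ :=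
  if κ = (2, 4) ∨ κ = (3, 2) then (3, 2) else (3, 1)

/-- Below 10 points (2, 2) and (3, 2) have no disjoint representatives, so (2, 4) and (3, 2) are
linked only to each other. -/
theorem twoClasses_eq_of_keyLink {n : ℕ} (hn : n ≤ 9) {κ κ' : ℕ × ℕ} (h : KeyLink n κ κ') :
    twoClasses κ = twoClasses κ' := by
  have key : ∀ κ κ', KeyLink n κ κ' → κ = (2, 4) ∨ κ = (3, 2) → κ' = (2, 4) ∨ κ' = (3, 2) := by
    rintro κ ⟨q, l⟩ h hκ
    have hq := (le_of_mem_keys h.mem_right).1.trans hn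
    obtain ⟨-, h2, h3, h4, h5, a, b, c, h6, h7, h8, h9, h10⟩ := h
    rw [Nat.even_iff] at h9 h10
    simp only [Prod.mk.injEq]
    rcases hκ with rfl | rfl <;> dsimp only at * <;> interval_cases q <;>
      first | omega | exact absurd h2 (by norm_num)
  rw [twoClasses, twoClasses, if_congr ⟨key κ κ' h, key κ' κ h.symm⟩ rfl rfl]

theorem keyLink_three_sq_two_four {n : ℕ} (hn : 8 ≤ n) : KeyLink n (3, 2) (2, 4) :=
  keyLink_three_sq_two_pow (by decide) le_rfl hn

theorem reach_twoClasses {n : ℕ} (hn : 8 ≤ n) {κ : ℕ × ℕ}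
    (h : κ ∈ ({(2, 2), (2, 4), (3, 1), (3, 2), (5, 1)} : Finset (ℕ × ℕ))) :
    twoClasses κ ∈ ({(3, 1), (3, 2)} : Finset (ℕ × ℕ)) ∧
      ReflTransGen (KeyLink n) (twoClasses κ) κ := by
  refine ⟨by revert κ; decide, ?_⟩
  simp only [Finset.mem_insert, Finset.mem_singleton] at h
  rcases h with rfl | rfl | rfl | rfl | rfl
  · exact ReflTransGen.single (keyLink_two_three (by omega))
  · exact ReflTransGen.single (keyLink_three_sq_two_four hn)
  · exact ReflTransGen.refl
  · exact ReflTransGen.refl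
  · exact ReflTransGen.single (keyLink_three_prime Nat.prime_five le_rfl hn)

theorem keyClassification_eight :
    KeyClassification 8 {(3, 1), (3, 2)} {(7, 1)} twoClasses where
  isolated κ hκ := ⟨(mem_keys_eight κ).1 (by
    revert κ
    decide), not_keyLink_eight κ hκ⟩
  main m hm := ⟨(mem_keys_eight m).1 (by
    revert m
    decide), by revert m; decide, by revert m; decide⟩
  link _ _ h := twoClasses_eq_of_keyLink (by norm_num) h
  reach κ hκ hκI := by
    refine reach_twoClasses (by norm_num) ?_
    rw [← mem_keys_eight] at hκ
    revert κ
    decide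

theorem altCounts_eight : AltCounts 8 962 3 2 := by
  refine keyClassification_eight.altCounts (J := {7}) ?_ (by decide) (by decide) ?_ ?_ ?_
    (by decide)
  · rw [keyClassification_eight.numComponents_power]
    · rw [Finset.card_pair (by decide)]
      norm_num [subgroupCount, Nat.factorial]
    · intro m hm
      simp only [Finset.mem_insert, Finset.mem_singleton] at hm
      rcases hm with rfl | rfl
      · exact mainKey_three (by norm_num)
      · exact mainKey_three_two_eight
  · intro p hp
    refine ⟨1, (mem_keys_eight _).1 ?_⟩
    rw [Finset.mem_singleton.1 hp]
    decide
  · intro κ hκ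
    rw [← mem_keys_eight] at hκ
    revert κ
    decide
  · intro κ hκ
    rw [Finset.mem_singleton.1 hκ]
    exact Or.inl (by decide)

theorem keyClassification_nine :
    KeyClassification 9 {(3, 1), (3, 2)} {(3, 3), (7, 1)} twoClasses where
  isolated κ hκ := ⟨(mem_keys_nine κ).1 (by
    revert κ
    decide), not_keyLink_nine κ hκ⟩
  main m hm := ⟨(mem_keys_nine m).1 (by
    revert m
    decide), by revert m; decide, by revert m; decide⟩
  link _ _ h := twoClasses_eq_of_keyLink (by norm_num) h
  reach κ hκ hκI := by
    refine reach_twoClasses (by norm_num) ?_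
    rw [← mem_keys_nine] at hκ
    revert κ
    decide

theorem altCounts_nine : AltCounts 9 5442 4 2 := by
  refine keyClassification_nine.altCounts (J := {7}) ?_ (by decide) (by decide) ?_ ?_ ?_
    (by decide)
  · rw [keyClassification_nine.numComponents_power]
    · rw [Finset.card_pair (by decide)]
      norm_num [subgroupCount, Nat.factorial]
    · intro m hm
      simp only [Finset.mem_insert, Finset.mem_singleton] at hm
      rcases hm with rfl | rfl
      · exact mainKey_three (by norm_num)
      · exact mainKey_three_two_nine
  · intro p hp
    refine ⟨1, (mem_keys_nine _).1 ?_⟩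
    rw [Finset.mem_singleton.1 hp]
    decide
  · intro κ hκ
    rw [← mem_keys_nine] at hκ
    revert κ
    decide
  · intro κ hκ
    simp only [Finset.mem_insert, Finset.mem_singleton] at hκ
    rcases hκ with rfl | rfl
    · exact Or.inr ⟨1, (mem_keys_nine _).1 (by decide), by decide⟩
    · exact Or.inl (by decide)

theorem keyClassification_ten :
    KeyClassification 10 {(3, 1)} {(3, 3), (5, 2)} fun _ => (3, 1) where
  isolated κ hκ := ⟨(mem_keys_ten κ).1 (by
    revert κ
    decide), not_keyLink_ten κ hκ⟩
  main m hm := by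
    obtain rfl := Finset.mem_singleton.1 hm
    exact ⟨(mem_keys_ten _).1 (by decide), by decide, rfl⟩
  link _ _ _ := rfl
  reach κ hκ hκI := by
    refine ⟨Finset.mem_singleton_self _, ?_⟩
    have h := (mem_keys_ten κ).2 hκ
    simp only [Finset.mem_insert, Finset.mem_singleton] at h hκI
    rcases h with rfl | rfl | rfl | rfl | rfl | rfl | rfl | rfl
    · exact reach_two le_rfl (by decide) (by norm_num) (by norm_num)
    · exact reach_two le_rfl (by decide) (by norm_num) (by norm_num)
    · exact ReflTransGen.refl
    · exact reach_three_sq le_rfl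
    · simp at hκI
    · exact ReflTransGen.single (keyLink_three_prime Nat.prime_five le_rfl (by norm_num))
    · simp at hκI
    · exact ReflTransGen.single (keyLink_three_prime (by norm_num) (by norm_num) (by norm_num))

theorem altCounts_ten : AltCounts 10 29345 3 1 := by
  refine keyClassification_ten.altCounts (J := ∅) ?_ (by decide) (by decide) ?_ ?_ ?_
    (by decide)
  · rw [keyClassification_ten.numComponents_power]
    · norm_num [subgroupCount, Nat.factorial]
    · intro m hm
      rw [Finset.mem_singleton.1 hm]
      exact mainKey_three (by norm_num)
  · exact fun p hp => absurd hp (Finset.notMem_empty p)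
  · exact fun κ _ hp => absurd hp (Finset.notMem_empty _)
  · intro κ hκ
    simp only [Finset.mem_insert, Finset.mem_singleton] at hκ
    rcases hκ with rfl | rfl
    · exact Or.inr ⟨1, (mem_keys_ten _).1 (by decide), by decide⟩
    · exact Or.inr ⟨1, (mem_keys_ten _).1 (by decide), by decide⟩

end SmallDegree

/-! ### Assembly of the theorem -/

theorem theoremA (n : ℕ) (hn : 3 ≤ n) :
    numComponents (properPowerGraph (alternatingGroup (Fin n))) =
      numComponents (properQuotientPowerGraph (alternatingGroup (Fin n))) ∧
    -- degrees from 3 to 10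
    (n = 3 → AltCounts n 1 1 1) ∧
    (n = 4 → AltCounts n 7 2 2) ∧
    (n = 5 → AltCounts n 31 3 3) ∧
    (n = 6 → AltCounts n 121 4 3) ∧
    (n = 7 → AltCounts n 421 4 3) ∧
    (n = 8 → AltCounts n 962 3 2) ∧
    (n = 9 → AltCounts n 5442 4 2) ∧
    (n = 10 → AltCounts n 29345 3 1) ∧
    -- degrees at least 11
    (11 ≤ n →
      (n ∈ primesAffine 1 2 → n ∈ primesAffine 2 1 →
        AltCounts n ((n : ℚ) * (n - 1) * ((n - 4).factorial : ℚ) / 2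
          + 4 * n * (n - 2) * ((n - 4).factorial : ℚ) / (n - 1) + 1) 3 2) ∧
      (n.Prime → n ∈ primesAffine 2 1 →
        AltCounts n (((n - 2).factorial : ℚ)
          + 4 * n * (n - 2) * ((n - 4).factorial : ℚ) / (n - 1) + 1) 3 2) ∧
      (n.Prime → n ∈ primesAffine 1 2 →
        AltCounts n (((n - 2).factorial : ℚ)
          + (n : ℚ) * (n - 1) * ((n - 4).factorial : ℚ) / 2 + 1) 3 3) ∧
      (n ∈ primesAffine 1 2 → ¬ n.Prime → n ∉ primesAffine 2 1 →
        AltCounts n ((n : ℚ) * (n - 1) * ((n - 4).factorial : ℚ) / 2 + 1) 2 2) ∧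
      (n ∈ primesAffine 2 1 → ¬ n.Prime → n ∉ primesAffine 1 2 →
        AltCounts n (4 * n * (n - 2) * ((n - 4).factorial : ℚ) / (n - 1) + 1) 2 1) ∧
      (n.Prime → n ∉ primesAffine 1 2 → n ∉ primesAffine 2 1 →
        AltCounts n (((n - 2).factorial : ℚ) + 1) 2 2) ∧
      (n ∈ primesAffine 1 1 → n ∉ primesAffine 2 0 →
        AltCounts n (n * ((n - 3).factorial : ℚ) + 1) 2 2) ∧
      (n ∈ primesAffine 1 1 → n ∈ primesAffine 2 0 →
        AltCounts n (4 * (n - 1) * ((n - 3).factorial : ℚ) / n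
          + n * ((n - 3).factorial : ℚ) + 1) 3 2) ∧
      (n ∈ primesAffine 2 0 → n ∉ primesAffine 1 1 →
        AltCounts n (4 * (n - 1) * ((n - 3).factorial : ℚ) / n + 1) 2 1) ∧
      (n ∉ criticalDegrees → AltCounts n 1 1 1)) := by
  refine ⟨numComponents_properQuotientPowerGraph _, ?_, ?_, ?_, ?_, ?_, ?_, ?_, ?_, ?_⟩
  · rintro rfl
    exact altCounts_three
  · rintro rfl
    exact altCounts_four
  · rintro rfl
    exact altCounts_five
  · rintro rfl
    exact altCounts_six
  · rintro rfl
    exact altCounts_seven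
  · rintro rfl
    exact altCounts_eight
  · rintro rfl
    exact altCounts_nine
  · rintro rfl
    exact altCounts_ten
  · exact altCounts_of_critical
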